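/- Let $m\ge 4$, $n\ge 3$, $t\ge 1$ be integers, and let all coefficients be in $\mathbb Z_2$. **The complex $(A_t^*,d_1)$.** Let $C_m$ be the cycle with vertex set $\mathbb Z/m$ and $K_n$ the complete graph on $[n]=\{1,\dots,n\}$. Let $\mathrm{Hom}_+(C_m,K_n)$ be the simplicial complex whose simplices are the maps $\eta:V(C_m)\to 2^{[n]}$, not identically $\emptyset$, with $\eta(x)\cap\eta(y)=\emptyset$ for adjacent $x,y$; the dimension of $\eta$ is $\sum_x|\eta(x)|-1$, and $\operatorname{supp}\eta=\{x:\eta(x)\neq\emptyset\}$. Filter its cochain complex by letting $F^p$ be spanned by the duals $\eta^*$ of the simplices with $|\operatorname{supp}\eta|\ge p+1$, and let $E_1^{p,q}=H^{p+q}(F^p/F^{p+1})$ with the first differential $d_1:E_1^{p,q}\to E_1^{p+1,q}$ of the associated spectral sequence. A $t$-arc picture is a pair $(S,A)$ where $S\subsetneq V(C_m)$ and $A$ is a set of $t$ connected components (arcs) of the induced subgraph $C_m[S]$, each having at least two vertices. For an arc $a=[a_\bullet,a^\bullet]$ put $\widehat a=[a_\bullet-1,a^\bullet+1]$ (all of $V(C_m)$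 if $|a|=m-1$), and set $\widehat A=\bigcup_{a\in A}\widehat a$, $A_\bullet=\{a_\bullet:a\in A\}$. Let $\sigma^S_{A_\bullet}=\sum_\eta\eta^*$, summed over the simplices $\eta$ with support $S$, with $\eta(v)=[n-1]$ for $v\in A_\bullet$ and $|\eta(w)|=1$ for $w\in S\setminus A_\bullet$. Let $A_t^p\subseteq E_1^{p,t(n-2)}$ be the span of the classes $[\sigma^S_{A_\bullet}]$ of all $t$-arc pictures with $|S|=p+1$ and $\widehat A=V(C_m)$. In particular $A_t^{p}=0$ for $p\geq m-1$. The differential of $A_t^*$ is the restriction of $d_1$, except that for $t=1$ the differential $A_1^{m-2}\to A_1^{m-1}=0$ is taken to be zero. **The complex $\Phi_{t,m,3}$.** This is the cubical complex whose cubes are the collections of $t$ subsets of the circular $m$-set $\mathbb Z/m$, each subset being a single point or a pair of points at distance $1$, such that points in different subsets have circular distance at least $3$. The dimension of a cube is the number of its two-element sets, and a cube is a face of another if every set of the latter contains a set of the former. **Proposition.** The differential $d_1$ maps $A_t^p$ into $A_t^{p+1}$ for all $p$ (except possibly for $t=1$, $p=m-2$), so that $(A_t^*,d_1)$ is a complex,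 and the cellular chain complex $(C_*(\Phi_{t,m,3};\mathbb Z_2),\partial)$ is isomorphic to $(A_t^*,d_1)$, with $C_i(\Phi_{t,m,3};\mathbb Z_2)$ corresponding to $A_t^{m-t-i-1}$ for all integers $i$: there are linear isomorphisms $e_i:C_i(\Phi_{t,m,3};\mathbb Z_2)\to A_t^{m-t-i-1}$ with $e_{i-1}\circ\partial=d_1\circ e_i$ for all $i$, where for $t=1$, $i=0$ the right-hand side is the differential $A_1^{m-2}\to A_1^{m-1}=0$. -/

import Mathlib

noncomputable section

namespace CycleColorings

/-! ### The complex of partial homomorphisms and its cochains over the field with two elements -/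

/-- `Hom_+(T, G)`. The simplices of the join of copies of the full simplex on `W`, one copy for
each vertex of `T`, are the nonempty finite sets `s` of pairs `(x, a)` with `x : V`, `a : W`;
the pairs over `x` form the factor `s_x`. Such an `s` is a simplex of `Hom_+(T, G)` if for adjacent
`x, y` every element of `s_x` is adjacent to every element of `s_y`. -/
def HomPlus {V W : Type} (T : SimpleGraph V) (G : SimpleGraph W) : Type :=
  {s : Finset (V × W) //
    s.Nonempty ∧ ∀ u ∈ s, ∀ v ∈ s, T.Adj u.1 v.1 → G.Adj u.2 v.2}

variable {V W : Type} [Fintype V] [Fintype W] (T : SimpleGraph V) (G : SimpleGraph W)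

instance : Fintype (HomPlus T G) := by
  classical
  unfold HomPlus
  infer_instance

/-- Cochains of `Hom_+(T, G)` with coefficients in `ℤ/2`, all degrees together. -/
abbrev Cochain : Type := HomPlus T G → ZMod 2

/-- `r` is a face of codimension one of `s`. -/
def IsFacet {T : SimpleGraph V} {G : SimpleGraph W} (r s : HomPlus T G) : Prop :=
  r.1 ⊆ s.1 ∧ r.1.card + 1 = s.1.card

open Classical in
/-- The coboundary operator over `ℤ/2`. -/
def coboundary : Cochain T G →ₗ[ZMod 2] Cochain T G where
  toFun c := fun s => ∑ r : HomPlus T G, if IsFacet r s then c r else 0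
  map_add' c c' := by
    funext s
    simp only [Pi.add_apply, ← Finset.sum_add_distrib]
    refine Finset.sum_congr rfl fun r _ => ?_
    split_ifs <;> simp
  map_smul' k c := by
    funext s
    simp only [Pi.smul_apply, smul_eq_mul, RingHom.id_apply, Finset.mul_sum]
    refine Finset.sum_congr rfl fun r _ => ?_
    split_ifs <;> simp

open Classical in
theorem coboundary_coboundary (c : Cochain T G) :
    coboundary T G (coboundary T G c) = 0 := by
  funext s
  change (∑ r : HomPlus T G, if IsFacet r s then
    (∑ q : HomPlus T G, if IsFacet q r then c q else 0) else 0) = 0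
  have h1 : (∑ r : HomPlus T G, if IsFacet r s then
      (∑ q : HomPlus T G, if IsFacet q r then c q else 0) else 0) =
      ∑ r : HomPlus T G, ∑ q : HomPlus T G, if IsFacet r s ∧ IsFacet q r then c q else 0 := by
    refine Finset.sum_congr rfl fun r _ => ?_
    by_cases h : IsFacet r s <;> simp [h]
  rw [h1, Finset.sum_comm]
  refine Finset.sum_eq_zero fun q _ => ?_
  rw [← Finset.sum_filter]
  have key : ∀ r : HomPlus T G, IsFacet r s ∧ IsFacet q r →
      (q.1 ∪ (s.1 \ r.1)) ⊆ s.1 := by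
    rintro r ⟨h, h'⟩
    exact Finset.union_subset (h'.1.trans h.1) Finset.sdiff_subset
  have cardkey : ∀ r : HomPlus T G, IsFacet r s ∧ IsFacet q r →
      (q.1 ∪ (s.1 \ r.1)).card = q.1.card + 1 := by
    rintro r ⟨h, h'⟩
    rw [Finset.card_union_of_disjoint, Finset.card_sdiff_of_subset h.1]
    · have := h.2
      omega
    · exact Finset.disjoint_of_subset_left h'.1 Finset.disjoint_sdiff
  let g : ∀ r ∈ (Finset.univ.filter fun r : HomPlus T G => IsFacet r s ∧ IsFacet q r),
      HomPlus T G := fun r hr =>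
    ⟨q.1 ∪ (s.1 \ r.1), q.2.1.mono Finset.subset_union_left,
      fun u hu v hv => s.2.2 u (key r (Finset.mem_filter.1 hr).2 hu) v
        (key r (Finset.mem_filter.1 hr).2 hv)⟩
  refine Finset.sum_involution g ?_ ?_ ?_ ?_
  · intro r _
    exact CharTwo.add_self_eq_zero _
  · intro r hr _ heq
    have hr' := (Finset.mem_filter.1 hr).2
    have e : q.1 ∪ (s.1 \ r.1) = r.1 := congrArg Subtype.val heq
    have hss : s.1 ⊆ r.1 := by
      intro u hu
      by_contra hur
      exact hur (e ▸ Finset.mem_union_right _ (Finset.mem_sdiff.2 ⟨hu, hur⟩))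
    have := Finset.card_le_card hss
    have := hr'.1.2
    omega
  · intro r hr
    have hr' := (Finset.mem_filter.1 hr).2
    have hc := cardkey r hr'
    refine Finset.mem_filter.2 ⟨Finset.mem_univ _, ⟨key r hr', ?_⟩,
      ⟨Finset.subset_union_left, hc.symm⟩⟩
    change (q.1 ∪ (s.1 \ r.1)).card + 1 = _
    have := hr'.1.2
    have := hr'.2.2
    omega
  · intro r hr
    have hr' := (Finset.mem_filter.1 hr).2
    apply Subtype.ext
    change q.1 ∪ (s.1 \ (q.1 ∪ (s.1 \ r.1))) = r.1
    have h1 := hr'.1.1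
    have h2 := hr'.2.1
    ext u
    have h1u := @h1 u
    have h2u := @h2 u
    simp only [Finset.mem_union, Finset.mem_sdiff]
    tauto

open Classical in
/-- The support of a simplex: the set of `x` for which `s_x` is nonempty. -/
def HomPlus.supp {T : SimpleGraph V} {G : SimpleGraph W} (s : HomPlus T G) : Finset V :=
  s.1.image Prod.fst

open Classical in
/-- The factor `s_x` of a simplex `s`. -/
def HomPlus.fiber {T : SimpleGraph V} {G : SimpleGraph W} (s : HomPlus T G) (x : V) : Finset W :=
  Finset.univ.filter fun a => (x, a) ∈ s.1

/-! ### The first page of the spectral sequence of the support filtration -/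

/-- `F^p C^k`: cochains concentrated on the simplices of dimension `k` (that is, with `k + 1`
vertices) whose support has at least `p + 1` elements. -/
def filt (p k : ℤ) : Submodule (ZMod 2) (Cochain T G) where
  carrier := {c | ∀ s, c s ≠ 0 → (s.1.card : ℤ) = k + 1 ∧ p + 1 ≤ (s.supp.card : ℤ)}
  zero_mem' := by
    intro s hs
    exact absurd rfl hs
  add_mem' := by
    intro a b ha hb s hs
    by_cases h : a s = 0
    · refine hb s fun h' => hs ?_
      simp [h, h']
    · exact ha s h
  smul_mem' := by
    intro k a ha s hs
    refine ha s fun h => hs ?_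
    simp [h]

/-- Representatives of classes of `H^{p+q}(F^p / F^{p+1})`:
elements of `F^p C^{p+q}` with coboundary in `F^{p+1}`. -/
def firstCycles (p q : ℤ) : Submodule (ZMod 2) (Cochain T G) :=
  filt T G p (p + q) ⊓ (filt T G (p + 1) (p + q + 1)).comap (coboundary T G)

/-- The elements representing zero: `F^{p+1} C^{p+q}` plus the coboundaries of `F^p C^{p+q-1}`. -/
def firstBoundaries (p q : ℤ) : Submodule (ZMod 2) (Cochain T G) :=
  filt T G (p + 1) (p + q) ⊔ (filt T G p (p + q - 1)).map (coboundary T G)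

/-- `E_1^{p,q} = H^{p+q}(F^p / F^{p+1})`. -/
abbrev FirstPage (p q : ℤ) : Type :=
  firstCycles T G p q ⧸ (firstBoundaries T G p q).submoduleOf (firstCycles T G p q)

theorem coboundary_mem_firstCycles (p q : ℤ) (c : Cochain T G) (hc : c ∈ firstCycles T G p q) :
    coboundary T G c ∈ firstCycles T G (p + 1) q := by
  refine ⟨?_, ?_⟩
  · have h : coboundary T G c ∈ filt T G (p + 1) (p + q + 1) := hc.2
    have e : p + 1 + q = p + q + 1 := by ring
    rw [e]
    exact h
  · rw [SetLike.mem_coe, Submodule.mem_comap, coboundary_coboundary]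
    exact Submodule.zero_mem _

/-- The first differential `d_1 : E_1^{p,q} → E_1^{p+1,q}`, `[c] ↦ [δ c]`. -/
def firstDifferential (p q : ℤ) : FirstPage T G p q →ₗ[ZMod 2] FirstPage T G (p + 1) q :=
  Submodule.mapQ _ _
    ((coboundary T G).restrict (p := firstCycles T G p q) (q := firstCycles T G (p + 1) q)
      (coboundary_mem_firstCycles T G p q)) (by
    rintro ⟨c, hc⟩ h
    change c ∈ firstBoundaries T G p q at h
    change coboundary T G c ∈ firstBoundaries T G (p + 1) q
    obtain ⟨a, ha, b, hb, hab⟩ := Submodule.mem_sup.1 h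
    obtain ⟨b', -, rfl⟩ := hb
    change a + _ = c at hab
    rw [← hab, map_add, coboundary_coboundary, add_zero]
    refine Submodule.mem_sup_right ⟨a, ?_, rfl⟩
    rw [show p + 1 + q - 1 = p + q by ring]
    exact ha)

/-! ### Arc pictures on the cycle `C_m` and the complex they generate -/

/-- `a` is an arc of `S`: the vertex set of a connected component of `C_m[S]` with at least
two vertices. -/
def IsArc {m : ℕ} (S a : Finset (Fin m)) : Prop :=
  2 ≤ a.card ∧
    ∃ c : ((SimpleGraph.cycleGraph m).induce (S : Set (Fin m))).ConnectedComponent,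
      (a : Set (Fin m)) = Subtype.val '' c.supp

/-- A `t`-arc picture `(S, A)`: a proper set `S` of vertices of `C_m` and a set `A` of `t` of
its arcs. -/
structure ArcPicture (m t : ℕ) where
  S : Finset (Fin m)
  A : Finset (Finset (Fin m))
  proper : S ≠ Finset.univ
  isArc : ∀ a ∈ A, IsArc S a
  card_eq : A.card = t

variable {m t : ℕ} [NeZero m]

/-- `A_•`: the set of the first vertices `a_•` of the arcs `a = [a_•, a^•]` in `A`. -/
def ArcPicture.first (P : ArcPicture m t) : Finset (Fin m) :=
  Finset.univ.filter fun x => ∃ a ∈ P.A, x ∈ a ∧ x - 1 ∉ a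

/-- `Â`: the union of the enlarged arcs `[a_• - 1, a^• + 1]` over all `a ∈ A`. -/
def ArcPicture.hat (P : ArcPicture m t) : Finset (Fin m) :=
  Finset.univ.filter fun x => ∃ a ∈ P.A, x ∈ a ∨ x + 1 ∈ a ∨ x - 1 ∈ a

open Classical in
/-- The cochain `σ_{A_•}^S` of `Hom_+(C_m, K_n)`: the sum of the duals of all simplices `η` with
support `S`, with `η(v) = [n-1]` (all colors except the last) for `v ∈ A_•`, and with
`η(w)` a single color for the other `w ∈ S`. -/
def ArcPicture.sigma (P : ArcPicture m t) (n : ℕ) :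
    Cochain (SimpleGraph.cycleGraph m) (⊤ : SimpleGraph (Fin n)) := fun η =>
  if η.supp = P.S ∧
      (∀ v ∈ P.first, η.fiber v = Finset.univ.filter fun k : Fin n => (k : ℕ) + 1 < n) ∧
      (∀ w ∈ P.S, w ∉ P.first → (η.fiber w).card = 1)
    then 1 else 0

/-- The row `E_1^{*,t(n-2)}` of the first page for `Hom_+(C_m, K_n)`. -/
abbrev RowPage (m n t : ℕ) (p : ℤ) : Type :=
  FirstPage (SimpleGraph.cycleGraph m) (⊤ : SimpleGraph (Fin n)) p (t * ((n : ℤ) - 2))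

/-- The differential `d_1` of the row `E_1^{*,t(n-2)}`. -/
abbrev rowDifferential (m n t : ℕ) (p : ℤ) :
    RowPage m n t p →ₗ[ZMod 2] RowPage m n t (p + 1) :=
  firstDifferential (SimpleGraph.cycleGraph m) (⊤ : SimpleGraph (Fin n)) p (t * ((n : ℤ) - 2))

/-- `A_t^p`: the subspace of `E_1^{p,t(n-2)}` spanned by the classes `[σ_{A_•}^S]` of all
`t`-arc pictures `(S, A)` with `|S| = p + 1` and `Â = V(C_m)`. -/
def arcModule (m n t : ℕ) [NeZero m] (p : ℤ) : Submodule (ZMod 2) (RowPage m n t p) :=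
  Submodule.span (ZMod 2)
    {x | ∃ P : ArcPicture m t, (P.S.card : ℤ) = p + 1 ∧ P.hat = Finset.univ ∧
      ∃ h : P.sigma n ∈ firstCycles (SimpleGraph.cycleGraph m) (⊤ : SimpleGraph (Fin n)) p
        (t * ((n : ℤ) - 2)), x = Submodule.Quotient.mk ⟨P.sigma n, h⟩}

/-! ### The cubical complex `Φ_{t,m,g}` -/

/-- Distance of two points of the circular `m`-set. -/
def circDist {m : ℕ} (x y : Fin m) : ℕ := min (x - y).val (y - x).val

/-- The cubes of `Φ_{t,m,g}`: collections of `t` sets, each of them a single point of the circular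
`m`-set or a pair of points at distance `1`, points of different sets being at distance at
least `g`. -/
structure PhiCube (t m g : ℕ) where
  sets : Finset (Finset (Fin m))
  card_eq : sets.card = t
  shape : ∀ s ∈ sets, (∃ x, s = {x}) ∨ ∃ x y, circDist x y = 1 ∧ s = {x, y}
  separated : ∀ s ∈ sets, ∀ s' ∈ sets, s ≠ s' → ∀ x ∈ s, ∀ y ∈ s', g ≤ circDist x y

/-- The dimension of a cube is the number of its two-element sets. -/
def PhiCube.dim {t m g : ℕ} (c : PhiCube t m g) : ℕ :=
  (c.sets.filter fun s => s.card = 2).card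

/-- `c'` is a face of `c`: every set of `c` contains a set of `c'`. (Both collections
consist of `t` sets.) -/
def PhiCube.IsFace {t m g : ℕ} (c' c : PhiCube t m g) : Prop :=
  ∀ s ∈ c.sets, ∃ s' ∈ c'.sets, s' ⊆ s

instance (t m g : ℕ) : Finite (PhiCube t m g) :=
  Finite.of_injective (fun c : PhiCube t m g => c.sets) (by
    rintro ⟨⟩ ⟨⟩ h
    simpa using h)

instance (t m g : ℕ) : Fintype (PhiCube t m g) := Fintype.ofFinite _

/-- The cubes of dimension `i` (there are none for `i < 0`). -/
abbrev PhiCell (t m g : ℕ) (i : ℤ) : Type := {c : PhiCube t m g // (c.dim : ℤ) = i}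

instance (t m g : ℕ) (i : ℤ) : Fintype (PhiCell t m g i) := Fintype.ofFinite _

/-- Cellular chains `C_i(Φ_{t,m,g}; ℤ/2)`; a chain is given by its coefficients. -/
abbrev PhiChain (t m g : ℕ) (i : ℤ) : Type := PhiCell t m g i → ZMod 2

open Classical in
/-- The cellular boundary over `ℤ/2`: a cube is sent to the sum of its faces of codimension one,
so the coefficient of `c'` in the boundary of `f` is the sum of the coefficients in `f` of the
cubes `c` having `c'` as a face. -/
def phiBoundary (t m g : ℕ) (i : ℤ) : PhiChain t m g i →ₗ[ZMod 2] PhiChain t m g (i - 1) where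
  toFun f := fun c' => ∑ c : PhiCell t m g i, if c'.1.IsFace c.1 then f c else 0
  map_add' f f' := by
    funext s
    simp only [Pi.add_apply, ← Finset.sum_add_distrib]
    refine Finset.sum_congr rfl fun r _ => ?_
    split_ifs <;> simp
  map_smul' k f := by
    funext s
    simp only [Pi.smul_apply, smul_eq_mul, RingHom.id_apply, Finset.mul_sum]
    refine Finset.sum_congr rfl fun r _ => ?_
    split_ifs <;> simp

end CycleColorings

end

open CycleColorings

/-!
Let `S` be the vertex set of a `t`-arc picture whose enlarged arcs cover the cycle. Then `S` is the
union of its arcs, its complement consists of `t` gaps of one or two vertices, and these gaps are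
the sets of a cube of `Φ_{t,m,3}`. So the generators of `A_t^*` and the cubes both correspond to the
`Admissible` sets `S` (`ArcPicture.admissible_of_hat`, `PhiCube.admissible_compl_points`,
`Admissible.compl_points_cube`); passing to a face of codimension one means adding one vertex of a
gap of size two to `S` (`PhiCube.isFace_iff`, `sum_faces_eq`).

The differential is computed with cochains prescribed by a *profile*: a support, some fixed color
sets, and single colors elsewhere. Modulo two, the coboundary of such a cochain adds either a
vertex with a single color, or one color to a fixed color set (`coboundary_profile`). It follows
that all prescriptions `(A, Aᶜ)` on an edge of the cycle are cohomologous, in particular that the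
color set `[n - 1]` may be moved to an adjacent vertex (`profile_move`). If a vertex is added at the
end of an arc, the result is the generator of the larger picture; if it is added at the beginning,
one move gives that generator; if it merges two arcs, moves bring two color sets `[n - 1]` to
adjacent vertices, where they are incompatible, so the class vanishes
(`profile_insert_sub_mem`, `Admissible.coboundary_sub_mem`). The vanishing argument needs a
vertex outside the enlarged support; it is missing only when `t = 1` and the single arc is closed
up to the whole cycle, the exceptional degree of the statement.

Finally the generators are linearly independent, since each is detected by a cycle of colorings
with support `S` (`exists_isDualCycle`, `exists_dual_functional`). For arcs with two vertices
the cycle is the product of the fundamental cycles of the spheres `Hom(K₂, K_n)`. An arc with at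
least three vertices is folded onto the arc without its last vertex `w`, by sending `w` to `w - 2`;
the cycle is lifted along this fold by splitting the color set at `w - 2` with the
Alexander–Whitney diagonal (`IsDualCycle.unfold`).
-/

noncomputable section

namespace CycleColorings

set_option linter.unusedSectionVars false

/-! ### Cochains prescribed by a profile -/

section Profile

variable {V W : Type} [Fintype V] [Fintype W] [DecidableEq V] [DecidableEq W]
  {T : SimpleGraph V} {G : SimpleGraph W}

/-- The family of color sets `g` has support `S`, takes the prescribed values `F` on `D`, and
takes single colors on the rest of `S`. -/
def Conforms (S D : Finset V) (F g : V → Finset W) : Prop :=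
  ∀ v, ((g v).Nonempty ↔ v ∈ S) ∧ (v ∈ D → g v = F v) ∧ (v ∈ S → v ∉ D → (g v).card = 1)

open Classical in
/-- The sum of the duals of all simplices of `Hom_+(T, G)` which conform to the profile
`(S, D, F)`. -/
def profile (T : SimpleGraph V) (G : SimpleGraph W) (S D : Finset V) (F : V → Finset W) :
    Cochain T G :=
  fun η => if Conforms S D F η.fiber then 1 else 0

theorem HomPlus.mem_fiber {η : HomPlus T G} {v : V} {a : W} :
    a ∈ η.fiber v ↔ (v, a) ∈ η.1 := by
  simp [HomPlus.fiber]

theorem HomPlus.mem_supp {η : HomPlus T G} {v : V} :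
    v ∈ η.supp ↔ (η.fiber v).Nonempty := by
  simp [HomPlus.supp, HomPlus.mem_fiber, Finset.Nonempty]

theorem HomPlus.supp_eq_iff {η : HomPlus T G} {S : Finset V} :
    η.supp = S ↔ ∀ v, (η.fiber v).Nonempty ↔ v ∈ S := by
  simp [Finset.ext_iff, HomPlus.mem_supp]

theorem HomPlus.card_eq_sum (η : HomPlus T G) : η.1.card = ∑ v, (η.fiber v).card := by
  classical
  rw [Finset.card_eq_sum_card_fiberwise (f := Prod.fst) (t := Finset.univ) (by simp)]
  refine Finset.sum_congr rfl fun v _ => ?_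
  refine Finset.card_bij' (fun u _ => u.2) (fun a _ => (v, a)) ?_ ?_ ?_ ?_
  · rintro ⟨w, a⟩ hu
    obtain ⟨h, rfl⟩ := Finset.mem_filter.1 hu
    exact HomPlus.mem_fiber.2 h
  · intro a ha
    exact Finset.mem_filter.2 ⟨HomPlus.mem_fiber.1 ha, rfl⟩
  · rintro ⟨w, a⟩ hu
    obtain ⟨h, rfl⟩ := Finset.mem_filter.1 hu
    rfl
  · intro a ha
    rfl

theorem HomPlus.ext_fiber {η η' : HomPlus T G} (h : η.fiber = η'.fiber) : η = η' := by
  apply Subtype.ext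
  ext ⟨v, a⟩
  rw [← HomPlus.mem_fiber, h, HomPlus.mem_fiber]

theorem HomPlus.disjoint_fiber {η : HomPlus T (⊤ : SimpleGraph W)} {v w : V} (h : T.Adj v w) :
    Disjoint (η.fiber v) (η.fiber w) := by
  rw [Finset.disjoint_left]
  intro a ha hb
  exact η.2.2 _ (mem_fiber.1 ha) _ (mem_fiber.1 hb) h rfl

/-- A simplex of `Hom_+(T, K)`, `K` complete, given by its color sets. -/
def HomPlus.ofFiber (g : V → Finset W) (hne : ∃ v, (g v).Nonempty)
    (hg : ∀ v w, T.Adj v w → Disjoint (g v) (g w)) : HomPlus T (⊤ : SimpleGraph W) :=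
  ⟨Finset.univ.filter fun u => u.2 ∈ g u.1, by
    obtain ⟨v, a, ha⟩ := hne
    exact ⟨(v, a), by simpa using ha⟩, by
    intro u hu v hv huv
    simp only [Finset.mem_filter, Finset.mem_univ, true_and] at hu hv
    rw [SimpleGraph.top_adj]
    intro h
    exact Finset.disjoint_left.1 (hg _ _ huv) hu (h ▸ hv)⟩

@[simp]
theorem HomPlus.fiber_ofFiber (g : V → Finset W) (hne) (hg) :
    (HomPlus.ofFiber (T := T) g hne hg).fiber = g := by
  funext v
  ext a
  rw [HomPlus.mem_fiber]
  simp [HomPlus.ofFiber]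

/-- A facet arises by removing one color from one color set. -/
theorem isFacet_iff_exists_erase {r s : HomPlus T G} :
    IsFacet r s ↔ ∃ v, ∃ a ∈ s.fiber v,
      r.fiber = Function.update s.fiber v ((s.fiber v).erase a) := by
  constructor
  · rintro ⟨h, hc⟩
    obtain ⟨⟨v, a⟩, hu, hr⟩ := (Finset.exists_eq_insert_iff.2 ⟨h, hc⟩)
    refine ⟨v, a, HomPlus.mem_fiber.2 (hr ▸ Finset.mem_insert_self _ _), ?_⟩
    funext w
    ext b
    rw [HomPlus.mem_fiber]
    by_cases hw : w = v
    · subst hw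
      simp only [Function.update_self, Finset.mem_erase, HomPlus.mem_fiber, ← hr,
        Finset.mem_insert, Prod.mk.injEq, true_and]
      grind
    · rw [Function.update_of_ne hw, HomPlus.mem_fiber, ← hr]
      simp [hw]
  · rintro ⟨v, a, ha, hr⟩
    have : r.1 = s.1.erase (v, a) := by
      ext ⟨w, b⟩
      rw [← HomPlus.mem_fiber, hr]
      by_cases hw : w = v
      · subst hw
        simp [HomPlus.mem_fiber]
      · rw [Function.update_of_ne hw, HomPlus.mem_fiber]
        simp [hw]
    rw [HomPlus.mem_fiber] at ha
    exact ⟨this ▸ Finset.erase_subset _ _, by rw [this, Finset.card_erase_add_one ha]⟩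

theorem update_erase_injective {g : V → Finset W} {v v' : V} {a a' : W}
    (ha : a ∈ g v) (ha' : a' ∈ g v')
    (h : Function.update g v ((g v).erase a) = Function.update g v' ((g v').erase a')) :
    v = v' ∧ a = a' := by
  have h1 := congrFun h v
  rw [Function.update_self] at h1
  have hv : v = v' := by
    by_contra hne
    rw [Function.update_of_ne hne] at h1
    rw [← h1] at ha
    simp at ha
  subst hv
  rw [Function.update_self] at h1
  refine ⟨rfl, ?_⟩
  by_contra hne
  have : a ∈ (g v).erase a' := Finset.mem_erase.2 ⟨hne, ha⟩
  rw [← h1] at this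
  simp at this

open Classical in
/-- The coboundary of a cochain which is a function of the color sets. -/
theorem coboundary_apply_fiber (f : (V → Finset W) → ZMod 2) (hf : f (fun _ => ∅) = 0)
    (η : HomPlus T G) :
    coboundary T G (fun r => f r.fiber) η =
      ∑ v, ∑ a ∈ η.fiber v, f (Function.update η.fiber v ((η.fiber v).erase a)) := by
  change (∑ r : HomPlus T G, if IsFacet r η then f r.fiber else 0) = _
  rw [← Finset.sum_filter, Finset.sum_sigma']
  symm
  have key : ∀ u ∈ Finset.univ.sigma (fun v => η.fiber v),
      f (Function.update η.fiber u.1 ((η.fiber u.1).erase u.2)) ≠ 0 →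
      ∃ r : HomPlus T G, r.fiber = Function.update η.fiber u.1 ((η.fiber u.1).erase u.2) := by
    rintro ⟨v, a⟩ hu hne
    simp only [Finset.mem_sigma, Finset.mem_univ, true_and] at hu
    have hsub : η.1.erase (v, a) ⊆ η.1 := Finset.erase_subset _ _
    have hfib : ∀ w b, (w, b) ∈ η.1.erase (v, a) ↔
        b ∈ Function.update η.fiber v ((η.fiber v).erase a) w := by
      intro w b
      by_cases hw : w = v
      · subst hw
        simp [HomPlus.mem_fiber]
      · rw [Function.update_of_ne hw, HomPlus.mem_fiber]
        simp [hw]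
    refine ⟨⟨η.1.erase (v, a), ?_, fun x hx y hy => η.2.2 x (hsub hx) y (hsub hy)⟩, ?_⟩
    · by_contra hemp
      rw [Finset.not_nonempty_iff_eq_empty] at hemp
      apply hne
      convert hf using 2
      funext w
      ext b
      rw [← hfib, hemp]
      simp
    · funext w
      ext b
      exact HomPlus.mem_fiber.trans (hfib w b)
  have : Nonempty (HomPlus T G) := ⟨η⟩
  choose! i hi using key
  refine Finset.sum_bij_ne_zero (fun u _ _ => i u) ?_ ?_ ?_ ?_
  · intro u hu hne
    have hu' := (Finset.mem_sigma.1 hu).2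
    exact Finset.mem_filter.2 ⟨Finset.mem_univ _,
      isFacet_iff_exists_erase.2 ⟨u.1, u.2, hu', hi u hu hne⟩⟩
  · rintro ⟨v, a⟩ hu hne ⟨v', a'⟩ hu' hne' h
    have h1 := hi _ hu hne
    rw [h, hi _ hu' hne'] at h1
    obtain ⟨rfl, rfl⟩ := update_erase_injective (Finset.mem_sigma.1 hu').2
      (Finset.mem_sigma.1 hu).2 h1
    rfl
  · intro r hr hne
    obtain ⟨v, a, ha, hr⟩ := isFacet_iff_exists_erase.1 (Finset.mem_filter.1 hr).2
    have hu : (⟨v, a⟩ : Σ _ : V, W) ∈ Finset.univ.sigma (fun v => η.fiber v) := by simpa using ha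
    have hne' : f (Function.update η.fiber v ((η.fiber v).erase a)) ≠ 0 := hr ▸ hne
    exact ⟨_, hu, hne', HomPlus.ext_fiber ((hi _ hu hne').trans hr.symm)⟩
  · intro u hu hne
    rw [hi u hu hne]

end Profile

/-! ### The coboundary of a profile cochain -/

section Profile

variable {V W : Type} [Fintype V] [Fintype W] [DecidableEq V] [DecidableEq W]
  {T : SimpleGraph V} {G : SimpleGraph W}

theorem conforms_update_iff {S D : Finset V} {F g : V → Finset W} {v : V} {X : Finset W} :
    Conforms S D F (Function.update g v X) ↔
      ((X.Nonempty ↔ v ∈ S) ∧ (v ∈ D → X = F v) ∧ (v ∈ S → v ∉ D → X.card = 1)) ∧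
      ∀ w, w ≠ v → ((g w).Nonempty ↔ w ∈ S) ∧ (w ∈ D → g w = F w) ∧
        (w ∈ S → w ∉ D → (g w).card = 1) :=
  Function.forall_update_iff g (a := v) (b := X) (p := fun u Y =>
    (Y.Nonempty ↔ u ∈ S) ∧ (u ∈ D → Y = F u) ∧ (u ∈ S → u ∉ D → Y.card = 1))

theorem conforms_iff_at {S D : Finset V} {F g : V → Finset W} (v : V) :
    Conforms S D F g ↔
      (((g v).Nonempty ↔ v ∈ S) ∧ (v ∈ D → g v = F v) ∧ (v ∈ S → v ∉ D → (g v).card = 1)) ∧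
      ∀ w, w ≠ v → ((g w).Nonempty ↔ w ∈ S) ∧ (w ∈ D → g w = F w) ∧
        (w ∈ S → w ∉ D → (g w).card = 1) := by
  conv_lhs => rw [← Function.update_eq_self v g]
  exact conforms_update_iff

open Classical in
/-- Removing a color over a vertex outside `S` leaves a conforming family exactly when that
vertex carried a single color. -/
theorem sum_conforms_erase_of_notMem {S D : Finset V} (hD : D ⊆ S) (F g : V → Finset W) {v : V}
    (hv : v ∉ S) :
    (∑ a ∈ g v, if Conforms S D F (Function.update g v ((g v).erase a)) then (1 : ZMod 2) else 0) =
      if Conforms (insert v S) D F g then 1 else 0 := by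
  have hvD : v ∉ D := fun h => hv (hD h)
  have hrest : (∀ w, w ≠ v → ((g w).Nonempty ↔ w ∈ insert v S) ∧ (w ∈ D → g w = F w) ∧
        (w ∈ insert v S → w ∉ D → (g w).card = 1)) ↔
      ∀ w, w ≠ v → ((g w).Nonempty ↔ w ∈ S) ∧ (w ∈ D → g w = F w) ∧
        (w ∈ S → w ∉ D → (g w).card = 1) := by
    refine forall_congr' fun w => imp_congr_right fun hw => ?_
    simp [hw]
  by_cases hc : (g v).card = 1
  · obtain ⟨a, ha⟩ := Finset.card_eq_one.1 hc
    rw [ha, Finset.sum_singleton]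
    refine if_congr ?_ rfl rfl
    rw [conforms_update_iff, conforms_iff_at (S := insert v S) v, hrest]
    simp [hv, hvD, ha]
  · rw [if_neg, Finset.sum_eq_zero]
    · intro a ha
      rw [if_neg]
      intro h
      have h0 := (conforms_update_iff.1 h).1.1
      simp only [hv, iff_false, Finset.not_nonempty_iff_eq_empty] at h0
      apply hc
      rw [← Finset.card_erase_add_one ha, h0, Finset.card_empty]
    · intro h
      exact hc ((h v).2.2 (Finset.mem_insert_self _ _) hvD)

open Classical in
/-- Over a vertex whose color set is only required to be a single color, the removals cancel in
pairs. -/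
theorem sum_conforms_erase_of_notMem_prescribed {S D : Finset V} (F g : V → Finset W) {v : V}
    (hv : v ∈ S) (hvD : v ∉ D) :
    (∑ a ∈ g v, if Conforms S D F (Function.update g v ((g v).erase a)) then (1 : ZMod 2) else 0) =
      0 := by
  by_cases hc : (g v).card = 2
  · have : ∀ a ∈ g v, (if Conforms S D F (Function.update g v ((g v).erase a)) then (1 : ZMod 2)
        else 0) = if ∀ w, w ≠ v → ((g w).Nonempty ↔ w ∈ S) ∧ (w ∈ D → g w = F w) ∧
        (w ∈ S → w ∉ D → (g w).card = 1) then 1 else 0 := by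
      intro a ha
      have h1 : ((g v).erase a).card = 1 := by rw [Finset.card_erase_of_mem ha, hc]
      refine if_congr ?_ rfl rfl
      rw [conforms_update_iff]
      have h2 : ((g v).erase a).Nonempty := Finset.card_pos.1 (by omega)
      simp [hv, hvD, h1, h2]
    rw [Finset.sum_congr rfl this, Finset.sum_const, hc, two_nsmul, CharTwo.add_self_eq_zero]
  · refine Finset.sum_eq_zero fun a ha => if_neg fun h => hc ?_
    have := (conforms_update_iff.1 h).1.2.2 hv hvD
    rw [← Finset.card_erase_add_one ha, this]

open Classical in
theorem sum_conforms_erase_of_mem_prescribed {S D : Finset V} (hD : D ⊆ S)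
    (F g : V → Finset W) {v : V} (hvD : v ∈ D) (hF : (F v).Nonempty) :
    (∑ a ∈ g v, if Conforms S D F (Function.update g v ((g v).erase a)) then (1 : ZMod 2) else 0) =
      ∑ a ∈ (F v)ᶜ, if Conforms S D (Function.update F v (insert a (F v))) g then 1 else 0 := by
  have hv := hD hvD
  have h1 : ∀ a, (a ∈ g v ∧ Conforms S D F (Function.update g v ((g v).erase a))) ↔
      (a ∉ F v ∧ Conforms S D (Function.update F v (insert a (F v))) g) := by
    intro a
    rw [conforms_update_iff, conforms_iff_at (F := Function.update F v (insert a (F v))) v]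
    have hrest : (∀ w, w ≠ v → ((g w).Nonempty ↔ w ∈ S) ∧
          (w ∈ D → g w = Function.update F v (insert a (F v)) w) ∧
          (w ∈ S → w ∉ D → (g w).card = 1)) ↔
        ∀ w, w ≠ v → ((g w).Nonempty ↔ w ∈ S) ∧ (w ∈ D → g w = F w) ∧
          (w ∈ S → w ∉ D → (g w).card = 1) := by
      refine forall_congr' fun w => imp_congr_right fun hw => ?_
      rw [Function.update_of_ne hw]
    rw [hrest, Function.update_self]
    simp only [hv, hvD, iff_true, true_imp_iff, not_true_eq_false, false_imp_iff, imp_true_iff,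
      and_true]
    constructor
    · rintro ⟨ha, ⟨hne, he⟩, hr⟩
      refine ⟨?_, ⟨⟨a, ha⟩, ?_⟩, hr⟩
      · rw [← he]; simp
      · rw [← he, Finset.insert_erase ha]
    · rintro ⟨ha, ⟨hne, he⟩, hr⟩
      rw [he, Finset.erase_insert ha]
      exact ⟨Finset.mem_insert_self _ _, ⟨hF, rfl⟩, hr⟩
  rw [← Finset.sum_filter, ← Finset.sum_filter]
  refine Finset.sum_congr ?_ fun _ _ => rfl
  ext a
  simpa using h1 a

/-- Modulo two, the coboundary of a profile cochain is obtained by adding a single color at a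
vertex outside the support, or one color to a prescribed color set. -/
theorem coboundary_profile {S D : Finset V} (hS : S.Nonempty) (hD : D ⊆ S) {F : V → Finset W}
    (hF : ∀ d ∈ D, (F d).Nonempty) :
    coboundary T G (profile T G S D F) = ∑ v ∈ Sᶜ, profile T G (insert v S) D F +
      ∑ d ∈ D, ∑ a ∈ (F d)ᶜ, profile T G S D (Function.update F d (insert a (F d))) := by
  classical
  funext η
  have h0 : ¬ Conforms S D F (fun _ => ∅) := by
    obtain ⟨s, hs⟩ := hS
    intro h
    simpa using (h s).1.2 hs
  have h2 : (coboundary T G (profile T G S D F)) η = _ :=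
    coboundary_apply_fiber (T := T) (G := G)
      (fun g => if Conforms S D F g then (1 : ZMod 2) else 0) (if_neg h0) η
  rw [h2, ← Finset.sum_compl_add_sum S, ← Finset.sum_sdiff hD, Pi.add_apply, Finset.sum_apply,
    Finset.sum_apply]
  congr 1
  · refine Finset.sum_congr rfl fun v hv => ?_
    exact sum_conforms_erase_of_notMem hD F η.fiber (Finset.mem_compl.1 hv)
  · rw [Finset.sum_eq_zero, zero_add]
    · refine Finset.sum_congr rfl fun d hd => ?_
      rw [Finset.sum_apply]
      exact sum_conforms_erase_of_mem_prescribed hD F η.fiber hd (hF d hd)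
    · intro v hv
      rw [Finset.mem_sdiff] at hv
      exact sum_conforms_erase_of_notMem_prescribed F η.fiber hv.1 hv.2

theorem profile_eq_zero {S D : Finset V} {F : V → Finset W}
    (h : ∀ η : HomPlus T G, ¬ Conforms S D F η.fiber) : profile T G S D F = 0 := by
  classical
  funext η
  exact if_neg (h η)

theorem profile_congr {S S' D D' : Finset V} {F F' : V → Finset W}
    (h : ∀ η : HomPlus T G, Conforms S D F η.fiber ↔ Conforms S' D' F' η.fiber) :
    profile T G S D F = profile T G S' D' F' := by
  classical
  funext η
  exact if_congr (h η) rfl rfl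

/-- A profile with overlapping color sets at adjacent vertices has no conforming simplex. -/
theorem profile_eq_zero_of_overlap {S D : Finset V} {F : V → Finset W} {x y : V}
    (hx : x ∈ D) (hy : y ∈ D) (hxy : T.Adj x y) {a : W} (hax : a ∈ F x) (hay : a ∈ F y) :
    profile T (⊤ : SimpleGraph W) S D F = 0 := by
  refine profile_eq_zero fun η h => ?_
  have hd := HomPlus.disjoint_fiber (η := η) hxy
  rw [(h x).2.1 hx, (h y).2.1 hy] at hd
  exact Finset.disjoint_left.1 hd hax hay

/-- No simplex uses all colors at a vertex having a neighbor in the support. -/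
theorem profile_eq_zero_of_univ {S D : Finset V} {F : V → Finset W} {x y : V}
    (hx : x ∈ D) (hy : y ∈ S) (hxy : T.Adj x y) (hF : F x = Finset.univ) :
    profile T (⊤ : SimpleGraph W) S D F = 0 := by
  refine profile_eq_zero fun η h => ?_
  have hd := HomPlus.disjoint_fiber (η := η) hxy
  obtain ⟨a, ha⟩ := (h y).1.2 hy
  rw [(h x).2.1 hx, hF] at hd
  exact Finset.disjoint_left.1 hd (Finset.mem_univ a) ha

theorem profile_mem_filt {S D : Finset V} (hD : D ⊆ S) {F : V → Finset W} {p k : ℤ}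
    (hp : p + 1 ≤ S.card) (hk : k + 1 = (S.card : ℤ) - D.card + ∑ d ∈ D, ((F d).card : ℤ)) :
    profile T G S D F ∈ filt T G p k := by
  classical
  intro η hη
  have hc : Conforms S D F η.fiber := by
    by_contra h
    exact hη (if_neg h)
  have hs : η.supp = S := HomPlus.supp_eq_iff.2 fun v => (hc v).1
  refine ⟨?_, by rw [hs]; exact hp⟩
  rw [hk, HomPlus.card_eq_sum, ← Finset.sum_compl_add_sum S, ← Finset.sum_sdiff hD,
    Finset.sum_eq_zero (s := Sᶜ), Finset.sum_congr rfl (g := fun _ => 1) (s₁ := S \ D),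
    Finset.sum_congr rfl (g := fun v => (F v).card) (s₁ := D)]
  · have := Finset.card_le_card hD
    rw [Finset.sum_const, Finset.card_sdiff_of_subset hD]
    simp [Nat.cast_sub this]
  · intro v hv
    rw [(hc v).2.1 hv]
  · intro v hv
    rw [Finset.mem_sdiff] at hv
    exact (hc v).2.2 hv.1 hv.2
  · intro v hv
    rw [Finset.card_eq_zero, ← Finset.not_nonempty_iff_eq_empty, (hc v).1]
    exact Finset.mem_compl.1 hv

theorem insert_compl_singleton {z a : W} (ha : a ∉ ({z}ᶜ : Finset W)) :
    insert a ({z}ᶜ : Finset W) = Finset.univ := by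
  have : a = z := by simpa using ha
  subst this
  ext b
  simp

/-- The coboundary of a cochain with all prescribed color sets `W \ {z}` only involves larger
supports. -/
theorem coboundary_profile_compl_singleton {S D : Finset V} (hS : S.Nonempty) (hD : D ⊆ S)
    (hnb : ∀ d ∈ D, ∃ u ∈ S, T.Adj d u) (z : W) (hW : 2 ≤ Fintype.card W) :
    coboundary T (⊤ : SimpleGraph W) (profile T ⊤ S D fun _ => {z}ᶜ) =
      ∑ v ∈ Sᶜ, profile T ⊤ (insert v S) D fun _ => {z}ᶜ := by
  rw [coboundary_profile hS hD, Finset.sum_eq_zero (s := D), add_zero]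
  · intro d hd
    refine Finset.sum_eq_zero fun a ha => ?_
    obtain ⟨u, hu, hdu⟩ := hnb d hd
    refine profile_eq_zero_of_univ hd hu hdu ?_
    rw [Function.update_self]
    exact insert_compl_singleton (Finset.mem_compl.1 ha)
  · intro d hd
    rw [← Finset.card_pos, Finset.card_compl, Finset.card_singleton]
    omega

theorem profile_compl_singleton_mem_filt {S D : Finset V} (hD : D ⊆ S) (z : W) {p k : ℤ}
    (hp : p + 1 ≤ S.card)
    (hk : k + 1 = (S.card : ℤ) + D.card * ((Fintype.card W : ℤ) - 2)) :
    profile T G S D (fun _ => {z}ᶜ) ∈ filt T G p k := by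
  have : 1 ≤ Fintype.card W := Fintype.card_pos_iff.2 ⟨z⟩
  refine profile_mem_filt hD hp ?_
  rw [hk, Finset.sum_const, Finset.card_compl, Finset.card_singleton, nsmul_eq_mul]
  push_cast [this]
  ring

theorem profile_mem_firstCycles {S D : Finset V} (hS : S.Nonempty) (hD : D ⊆ S)
    (hnb : ∀ d ∈ D, ∃ u ∈ S, T.Adj d u) (z : W) (hW : 2 ≤ Fintype.card W) {p q : ℤ}
    (hp : p + 1 = S.card) (hq : q = D.card * ((Fintype.card W : ℤ) - 2)) :
    profile T ⊤ S D (fun _ => {z}ᶜ) ∈ firstCycles T (⊤ : SimpleGraph W) p q := by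
  refine ⟨profile_compl_singleton_mem_filt hD z hp.le (by rw [← hp, ← hq]; ring), ?_⟩
  rw [SetLike.mem_coe, Submodule.mem_comap, coboundary_profile_compl_singleton hS hD hnb z hW]
  refine Submodule.sum_mem _ fun v hv => ?_
  have hc := Finset.card_insert_of_notMem (Finset.mem_compl.1 hv)
  refine profile_compl_singleton_mem_filt (hD.trans (Finset.subset_insert _ _)) z ?_ ?_
  · rw [hc]; push_cast; omega
  · rw [hc, ← hq]; push_cast; rw [← hp]; ring

/-- If two adjacent prescribed vertices use all colors but `c`, the two ways of distributing `c`
give cohomologous cochains. -/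
theorem profile_add_mem_firstBoundaries {S D : Finset V} {x y : V} {z c : W} {F : V → Finset W}
    (hD : D ⊆ S) (hx : x ∈ D) (hy : y ∈ D) (hxy : T.Adj x y)
    (hnb : ∀ d ∈ D, ∃ u ∈ S, T.Adj d u)
    (hFx : (F x).Nonempty) (hFy : (F y).Nonempty) (hW : 2 ≤ Fintype.card W)
    (hcx : c ∉ F x) (hcy : c ∉ F y) (hxy' : ∀ a, a ≠ c → (a ∈ F x ↔ a ∉ F y))
    (hF : ∀ d ∈ D, d ≠ x → d ≠ y → F d = {z}ᶜ) {p q : ℤ} (hp : p + 1 = S.card)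
    (hq : q = (D.card - 1) * ((Fintype.card W : ℤ) - 2)) :
    profile T ⊤ S D (Function.update F x (insert c (F x))) +
      profile T ⊤ S D (Function.update F y (insert c (F y))) ∈
        firstBoundaries T (⊤ : SimpleGraph W) p q := by
  have hne : x ≠ y := hxy.ne
  have hS : S.Nonempty := ⟨x, hD hx⟩
  have hcard : ∑ d ∈ D, ((F d).card : ℤ) = D.card * ((Fintype.card W : ℤ) - 1) -
      ((Fintype.card W : ℤ) - 1) := by
    have hyD : y ∈ D.erase x := Finset.mem_erase.2 ⟨hne.symm, hy⟩
    have hdisj : Disjoint (F x) (F y) := by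
      rw [Finset.disjoint_left]
      intro a hax hay
      have hac : a ≠ c := fun h => hcx (h ▸ hax)
      exact (hxy' a hac).1 hax hay
    have hsum : ((F x).card : ℤ) + (F y).card = (Fintype.card W : ℤ) - 1 := by
      rw [← Nat.cast_add, ← Finset.card_union_of_disjoint hdisj]
      have : F x ∪ F y = {c}ᶜ := by
        ext a
        rw [Finset.mem_union, Finset.mem_compl, Finset.mem_singleton]
        by_cases hac : a = c
        · subst hac; simp [hcx, hcy]
        · have := hxy' a hac
          tauto
      rw [this, Finset.card_compl, Finset.card_singleton]
      push_cast [show 1 ≤ Fintype.card W by omega]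
      ring
    rw [← Finset.add_sum_erase D _ hx, ← Finset.add_sum_erase _ _ hyD, ← add_assoc, hsum,
      Finset.sum_congr rfl (g := fun _ => (Fintype.card W : ℤ) - 1), Finset.sum_const,
      Finset.card_erase_of_mem hyD, Finset.card_erase_of_mem hx, nsmul_eq_mul]
    · have h2 : 2 ≤ D.card := by
        have := Finset.card_pos.2 ⟨y, hyD⟩
        rw [Finset.card_erase_of_mem hx] at this
        omega
      rw [Nat.sub_sub, Nat.cast_sub h2]
      push_cast
      ring
    · intro d hd
      simp only [Finset.mem_erase] at hd
      rw [hF d hd.2.2 hd.2.1 hd.1, Finset.card_compl, Finset.card_singleton]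
      push_cast [show 1 ≤ Fintype.card W by omega]
      ring
  have hmem : profile T (⊤ : SimpleGraph W) S D F ∈ filt T ⊤ p (p + q - 1) := by
    refine profile_mem_filt hD hp.le ?_
    rw [hcard, hq, ← hp]
    ring
  have hcob := coboundary_profile (T := T) (G := (⊤ : SimpleGraph W)) hS hD (F := F) (by
    intro d hd
    by_cases h1 : d = x
    · exact h1 ▸ hFx
    by_cases h2 : d = y
    · exact h2 ▸ hFy
    rw [hF d hd h1 h2, ← Finset.card_pos, Finset.card_compl, Finset.card_singleton]
    omega)
  have hsecond : ∑ d ∈ D, ∑ a ∈ (F d)ᶜ,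
        profile T (⊤ : SimpleGraph W) S D (Function.update F d (insert a (F d))) =
      profile T ⊤ S D (Function.update F x (insert c (F x))) +
      profile T ⊤ S D (Function.update F y (insert c (F y))) := by
    rw [Finset.sum_eq_add_of_mem x y hx hy hne]
    · congr 1
      · refine Finset.sum_eq_single_of_mem c (Finset.mem_compl.2 hcx) fun a ha hac => ?_
        have hay : a ∈ F y := by
          by_contra h
          exact Finset.mem_compl.1 ha ((hxy' a hac).2 h)
        refine profile_eq_zero_of_overlap hx hy hxy (a := a) ?_ ?_
        · simp
        · rwa [Function.update_of_ne hne.symm]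
      · refine Finset.sum_eq_single_of_mem c (Finset.mem_compl.2 hcy) fun a ha hac => ?_
        have hax : a ∈ F x := (hxy' a hac).2 (Finset.mem_compl.1 ha)
        refine profile_eq_zero_of_overlap hx hy hxy (a := a) ?_ ?_
        · rwa [Function.update_of_ne hne]
        · simp
    · intro d hd hdxy
      refine Finset.sum_eq_zero fun a ha => ?_
      obtain ⟨u, hu, hdu⟩ := hnb d hd
      refine profile_eq_zero_of_univ hd hu hdu ?_
      rw [hF d hd hdxy.1 hdxy.2] at ha ⊢
      rw [Function.update_self]
      exact insert_compl_singleton (Finset.mem_compl.1 ha)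
  rw [← hsecond]
  have hrw : ∑ d ∈ D, ∑ a ∈ (F d)ᶜ,
        profile T (⊤ : SimpleGraph W) S D (Function.update F d (insert a (F d))) =
      -∑ v ∈ Sᶜ, profile T (⊤ : SimpleGraph W) (insert v S) D F +
        coboundary T ⊤ (profile T ⊤ S D F) := by
    rw [hcob, neg_add_cancel_left]
  rw [hrw]
  refine Submodule.add_mem_sup (neg_mem (Submodule.sum_mem _ fun v hv => ?_)) ⟨_, hmem, rfl⟩
  have hc := Finset.card_insert_of_notMem (Finset.mem_compl.1 hv)
  refine profile_mem_filt (hD.trans (Finset.subset_insert _ _)) ?_ ?_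
  · rw [hc, ← hp.symm]; push_cast; omega
  · rw [hc, hcard, hq]; push_cast; rw [← hp]; ring

/-- A function of the nonempty proper subsets which does not change when an element is added is
constant: any two singletons are joined through the pair they form. -/
theorem eq_of_insert_eq {α : Type*} (hW : 3 ≤ Fintype.card W) (f : Finset W → α)
    (h : ∀ A c, A.Nonempty → c ∉ A → insert c A ≠ Finset.univ → f (insert c A) = f A)
    {A B : Finset W} (hA : A.Nonempty) (hA' : A ≠ Finset.univ) (hB : B.Nonempty)
    (hB' : B ≠ Finset.univ) : f A = f B := by
  have pair : ∀ a b : W, f {a} = f {b} := by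
    intro a b
    by_cases hab : a = b
    · rw [hab]
    have hlt : ({a, b} : Finset W) ≠ Finset.univ := by
      intro hu
      have := congrArg Finset.card hu
      rw [Finset.card_pair hab, Finset.card_univ] at this
      omega
    rw [← h {b} a (by simp) (by simpa using hab) hlt, Finset.pair_comm,
      h {a} b (by simp) (by simpa using Ne.symm hab) (by rwa [Finset.pair_comm])]
  have single : ∀ A : Finset W, A ≠ Finset.univ → ∀ a ∈ A, f A = f {a} := by
    intro A
    induction A using Finset.induction_on with
    | empty => intro _ a ha; simp at ha
    | insert c A hc ih =>
      intro hne a ha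
      have hA : A ≠ Finset.univ := fun hu => hc (hu ▸ Finset.mem_univ c)
      rcases A.eq_empty_or_nonempty with rfl | ⟨b, hb⟩
      · simp only [insert_empty_eq, Finset.mem_singleton] at ha
        simp [ha]
      · rw [h A c ⟨b, hb⟩ hc hne, ih hA b hb, pair b a]
  obtain ⟨a, ha⟩ := hA
  obtain ⟨b, hb⟩ := hB
  rw [single A hA' a ha, single B hB' b hb, pair]

end Profile

/-! ### Moving a prescribed vertex along an edge -/

section Profile

variable {V W : Type} [Fintype V] [Fintype W] [DecidableEq V] [DecidableEq W]
  {T : SimpleGraph V} {G : SimpleGraph W}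

/-- A vertex next to one that uses all colors but `z` has to take the single color `z`. -/
theorem profile_insert_insert {S D : Finset V} {x y : V} {z : W} {F : V → Finset W}
    (hxy : T.Adj x y) (hy : y ∈ S) (hyD : y ∉ D) (hFx : F x = {z}ᶜ) (hFy : F y = {z})
    (hF : ∀ d ∈ D, F d = {z}ᶜ) :
    profile T (⊤ : SimpleGraph W) S (insert x (insert y D)) F =
      profile T ⊤ S (insert x D) fun _ => {z}ᶜ := by
  have hne : x ≠ y := hxy.ne
  refine profile_congr fun η => ⟨fun h v => ⟨(h v).1, fun hv => ?_, fun hv hvD => ?_⟩,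
    fun h v => ⟨(h v).1, fun hv => ?_, fun hv hvD => ?_⟩⟩
  · rw [(h v).2.1 (by grind)]
    rcases Finset.mem_insert.1 hv with rfl | hv
    · exact hFx
    · exact hF v hv
  · by_cases hvy : v = y
    · subst hvy
      rw [(h v).2.1 (by simp), hFy, Finset.card_singleton]
    · exact (h v).2.2 hv (by grind)
  · by_cases hvy : v = y
    · subst hvy
      have h1 : η.fiber x = {z}ᶜ := (h x).2.1 (Finset.mem_insert_self _ _)
      have h2 := (h v).2.2 hy (by grind)
      obtain ⟨a, ha⟩ := Finset.card_eq_one.1 h2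
      have hd := HomPlus.disjoint_fiber (η := η) hxy
      rw [h1, ha, Finset.disjoint_singleton_right] at hd
      have haz : a = z := by simpa using hd
      rw [ha, hFy, haz]
    · rw [(h v).2.1 (by grind)]
      rcases Finset.mem_insert.1 hv with rfl | hv
      · exact hFx.symm
      · rcases Finset.mem_insert.1 hv with hv | hv
        · exact absurd hv hvy
        · exact (hF v hv).symm
  · exact (h v).2.2 hv (by grind)

/-- Prescribing all colors but `z` at a vertex is cohomologous to prescribing them at an adjacent
vertex: both are instances of the prescription `(A, Aᶜ)` on the edge, and `A` is varied one color
at a time. -/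
theorem profile_move {S D : Finset V} {x y : V} (z : W) (hx : x ∈ S) (hy : y ∈ S)
    (hxy : T.Adj x y) (hD : D ⊆ S) (hxD : x ∉ D) (hyD : y ∉ D)
    (hnb : ∀ d ∈ D, ∃ u ∈ S, T.Adj d u) (hW : 3 ≤ Fintype.card W) {p q : ℤ}
    (hp : p + 1 = S.card) (hq : q = (D.card + 1) * ((Fintype.card W : ℤ) - 2)) :
    profile T ⊤ S (insert x D) (fun _ => {z}ᶜ) - profile T ⊤ S (insert y D) (fun _ => {z}ᶜ) ∈
      firstBoundaries T (⊤ : SimpleGraph W) p q := by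
  have hne : x ≠ y := hxy.ne
  let F (A B : Finset W) : V → Finset W := fun v => if v = x then A else if v = y then B else {z}ᶜ
  have hFx : ∀ A B, F A B x = A := fun A B => by simp [F]
  have hFy : ∀ A B, F A B y = B := fun A B => by simp [F, hne.symm]
  have hFo : ∀ A B v, v ≠ x → v ≠ y → F A B v = {z}ᶜ := fun A B v h h' => by simp [F, h, h']
  have hupx : ∀ A B C, Function.update (F A B) x C = F C B := by
    intro A B C
    funext v
    by_cases h : v = x
    · subst h; rw [Function.update_self, hFx]
    · rw [Function.update_of_ne h]; simp [F, h]
  have hupy : ∀ A B C, Function.update (F A B) y C = F A C := by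
    intro A B C
    funext v
    by_cases h : v = y
    · subst h; rw [Function.update_self, hFy]
    · rw [Function.update_of_ne h]; simp [F, h]
  let E := insert x (insert y D)
  let f (A : Finset W) :
      Cochain T (⊤ : SimpleGraph W) ⧸ firstBoundaries T (⊤ : SimpleGraph W) p q :=
    Submodule.Quotient.mk (profile T ⊤ S E (F A Aᶜ))
  have hE : E ⊆ S := Finset.insert_subset hx (Finset.insert_subset hy hD)
  have hEcard : E.card = D.card + 2 := by
    have h1 : x ∉ insert y D := by
      rw [Finset.mem_insert]
      exact not_or.2 ⟨hne, hxD⟩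
    rw [Finset.card_insert_of_notMem h1, Finset.card_insert_of_notMem hyD]
  have hz : ({z}ᶜ : Finset W).Nonempty ∧ ({z}ᶜ : Finset W) ≠ Finset.univ := by
    refine ⟨?_, by simp⟩
    rw [← Finset.card_pos, Finset.card_compl, Finset.card_singleton]
    omega
  have hz' : ({z} : Finset W) ≠ Finset.univ := by
    intro h
    have := congrArg Finset.card h
    rw [Finset.card_univ, Finset.card_singleton] at this
    omega
  have hconst : f {z}ᶜ = f {z} := by
    refine eq_of_insert_eq hW f (fun A c hA hc hAc => ?_) hz.1 hz.2
      (Finset.singleton_nonempty z) hz'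
    refine (Submodule.Quotient.eq _).2 ?_
    have hcomp : insert c (insert c A)ᶜ = Aᶜ := by
      ext a
      by_cases hac : a = c
      · subst hac; simp [hc]
      · simp [hac]
    have key := profile_add_mem_firstBoundaries (T := T) (S := S) (D := E) (x := x) (y := y)
      (z := z) (c := c) (F := F A (insert c A)ᶜ) (p := p) (q := q) hE (by simp [E]) (by simp [E])
      hxy ?_ (by rwa [hFx]) ?_ (by omega) (by rwa [hFx]) (by rw [hFy]; simp) ?_
      (fun d _ h h' => hFo _ _ d h h') hp (by rw [hq, hEcard]; push_cast; ring)
    · rw [hFx, hFy, hupx, hupy, hcomp] at key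
      rwa [sub_eq_add_neg, ZModModule.neg_eq_self]
    · intro d hd
      simp only [E, Finset.mem_insert] at hd
      rcases hd with rfl | rfl | hd
      · exact ⟨y, hy, hxy⟩
      · exact ⟨x, hx, hxy.symm⟩
      · exact hnb d hd
    · rwa [hFy, ← Finset.compl_ne_univ_iff_nonempty, compl_compl]
    · intro a hac
      rw [hFx, hFy]
      simp [hac]
  have := (Submodule.Quotient.eq _).1 hconst
  rw [compl_compl, profile_insert_insert hxy hy hyD (hFx _ _) (hFy _ _)
    (fun d hd => hFo _ _ d (fun h => hxD (h ▸ hd)) (fun h => hyD (h ▸ hd)))] at this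
  have hE' : E = insert y (insert x D) := Finset.insert_comm _ _ _
  rwa [hE', profile_insert_insert hxy.symm hx hxD (hFy _ _) (hFx _ _)
    (fun d hd => hFo _ _ d (fun h => hxD (h ▸ hd)) (fun h => hyD (h ▸ hd)))] at this

end Profile

/-! ### Runs of consecutive vertices on the cycle -/

section Cycle

variable {m t : ℕ} [NeZero m]

theorem val_eq_one_two (hm : 4 ≤ m) :
    ((1 : Fin m) : ℕ) = 1 ∧ ((1 + 1 : Fin m) : ℕ) = 2 := by
  have h1 : ((1 : Fin m) : ℕ) = 1 := by
    rw [Fin.val_one', Nat.mod_eq_of_lt (by omega)]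
  refine ⟨h1, ?_⟩
  rw [Fin.val_add, h1, Nat.mod_eq_of_lt (by omega)]

theorem cycleGraph_adj_iff (hm : 4 ≤ m) {x y : Fin m} :
    (SimpleGraph.cycleGraph m).Adj x y ↔ x = y + 1 ∨ y = x + 1 := by
  obtain ⟨h1, -⟩ := val_eq_one_two hm
  rw [SimpleGraph.cycleGraph_adj', ← h1, ← Fin.ext_iff, ← Fin.ext_iff, sub_eq_iff_eq_add',
    sub_eq_iff_eq_add']

theorem one_ne_zero_fin (hm : 4 ≤ m) :
    (1 : Fin m) ≠ 0 ∧ (1 : Fin m) + 1 ≠ 0 ∧ (1 : Fin m) + 1 + 1 ≠ 0 := by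
  obtain ⟨h1, h2⟩ := val_eq_one_two hm
  have h3 : ((1 + 1 + 1 : Fin m) : ℕ) = 3 := by
    rw [Fin.val_add, h1, h2, Nat.mod_eq_of_lt (by omega)]
  refine ⟨fun h => ?_, fun h => ?_, fun h => ?_⟩ <;> simp [h] at *

theorem add_one_ne_self (hm : 4 ≤ m) (x : Fin m) :
    x + 1 ≠ x ∧ x + 1 + 1 ≠ x ∧ x + 1 + 1 + 1 ≠ x := by
  have h := one_ne_zero_fin hm
  refine ⟨by simpa using h.1, fun hx => h.2.1 ?_, fun hx => h.2.2 ?_⟩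
  · rwa [add_assoc, add_eq_left] at hx
  · rwa [add_assoc, add_assoc, add_eq_left, ← add_assoc] at hx

/-- A nonempty set closed under `x ↦ x - 1` is the whole cycle. -/
theorem mem_of_closed_sub_one {B : Fin m → Prop} (hB : ∀ x, B x → B (x - 1)) {x : Fin m}
    (hx : B x) (z : Fin m) : B z := by
  have h : ∀ k : ℕ, B (x - k • 1) := by
    intro k
    induction k with
    | zero => simpa using hx
    | succ k ih =>
      rw [succ_nsmul, ← sub_sub]
      exact hB _ ih
  have hk : ((x - z).val) • (1 : Fin m) = x - z := by
    have hval : ∀ k : ℕ, k < m → (k • (1 : Fin m)).val = k := by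
      intro k
      induction k with
      | zero => simp
      | succ k ih =>
        intro hk
        rw [succ_nsmul, Fin.val_add, ih (by omega), Fin.val_one', Nat.add_mod_mod,
          Nat.mod_eq_of_lt hk]
    exact Fin.ext (hval _ (x - z).isLt)
  have := h (x - z).val
  rwa [hk, sub_sub_cancel] at this

/-- The elements of `S` whose predecessor is not in `S`. -/
def firsts (S : Finset (Fin m)) : Finset (Fin m) := S.filter fun x => x - 1 ∉ S

theorem mem_firsts {S : Finset (Fin m)} {x : Fin m} : x ∈ firsts S ↔ x ∈ S ∧ x - 1 ∉ S := by
  simp [firsts]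

/-- All of `d, d + 1, …, x` are in `S`. -/
inductive Run (S : Finset (Fin m)) (d : Fin m) : Fin m → Prop
  | refl : d ∈ S → Run S d d
  | step (x : Fin m) : x ∈ S → Run S d (x - 1) → Run S d x

theorem Run.mem {S : Finset (Fin m)} {d x : Fin m} (h : Run S d x) : x ∈ S := by
  cases h <;> assumption

theorem Run.mono {S S' : Finset (Fin m)} (hS : S ⊆ S') {d x : Fin m} (h : Run S d x) :
    Run S' d x := by
  induction h with
  | refl h => exact .refl (hS h)
  | step x hx _ ih => exact .step x (hS hx) ih

theorem Run.of_sub_one_mem {S : Finset (Fin m)} {d x : Fin m} (h : Run S d x)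
    (hd : d ∈ firsts S) (hx : x - 1 ∈ S) : Run S d (x - 1) := by
  cases h with
  | refl h => exact absurd hx (mem_firsts.1 hd).2
  | step x hx h => exact h

theorem Run.unique {S : Finset (Fin m)} {d d' x : Fin m} (h : Run S d x) (h' : Run S d' x)
    (hd : d ∈ firsts S) (hd' : d' ∈ firsts S) : d = d' := by
  induction h with
  | refl h =>
    cases h' with
    | refl _ => rfl
    | step _ _ h' => exact absurd h'.mem (mem_firsts.1 hd).2
  | step x hx h ih => exact ih (h'.of_sub_one_mem hd' h.mem)

theorem exists_run {S : Finset (Fin m)} (hS : S ≠ Finset.univ) {x : Fin m} (hx : x ∈ S) :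
    ∃ d ∈ firsts S, Run S d x := by
  by_contra hno
  refine hS (Finset.eq_univ_iff_forall.2 fun z => ?_)
  refine (mem_of_closed_sub_one (B := fun y => y ∈ S ∧ ¬ ∃ d ∈ firsts S, Run S d y)
    ?_ ⟨hx, hno⟩ z).1
  rintro y ⟨hy, hyn⟩
  by_cases hy1 : y - 1 ∈ S
  · exact ⟨hy1, fun ⟨d, hd, h⟩ => hyn ⟨d, hd, .step y hy h⟩⟩
  · exact absurd ⟨y, mem_firsts.2 ⟨hy, hy1⟩, .refl hy⟩ hyn

/-- A run with more than one element contains the successor of its first element. -/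
theorem Run.add_one_mem {S : Finset (Fin m)} {d x : Fin m} (h : Run S d x) (hne : x ≠ d) :
    d + 1 ∈ S := by
  induction h with
  | refl h => exact absurd rfl hne
  | step x hx h ih =>
    by_cases hxd : x - 1 = d
    · rwa [← hxd, sub_add_cancel]
    · exact ih hxd

/-! ### Admissible vertex sets -/

/-- The vertex sets `S` of the arc pictures which generate the complex of arcs: `S` is the union
of its `t` arcs, and the complement consists of gaps of one or two vertices. -/
structure Admissible (t : ℕ) (S : Finset (Fin m)) : Prop where
  ne_univ : S ≠ Finset.univ
  not_isolated : ∀ x ∈ S, x - 1 ∈ S ∨ x + 1 ∈ S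
  gap : ∀ x, x ∈ S ∨ x + 1 ∈ S ∨ x + 1 + 1 ∈ S
  card_firsts : (firsts S).card = t

open Classical in
/-- The run of `S` with the first element `d`. -/
def arc (S : Finset (Fin m)) (d : Fin m) : Finset (Fin m) := Finset.univ.filter (Run S d)

theorem mem_arc {S : Finset (Fin m)} {d x : Fin m} : x ∈ arc S d ↔ Run S d x := by
  simp [arc]

theorem arc_injOn (S : Finset (Fin m)) : Set.InjOn (arc S) (firsts S : Set (Fin m)) := by
  intro d hd d' hd' h
  have h1 : d ∈ arc S d := mem_arc.2 (.refl (mem_firsts.1 hd).1)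
  exact (mem_arc.1 h1).unique (mem_arc.1 (h ▸ h1)) hd hd'

theorem reachable_of_run (hm : 4 ≤ m) {S : Finset (Fin m)} {d x : Fin m} (h : Run S d x)
    (hd : d ∈ S) :
    ((SimpleGraph.cycleGraph m).induce (S : Set (Fin m))).Reachable ⟨d, hd⟩ ⟨x, h.mem⟩ := by
  induction h with
  | refl h => exact .refl _
  | step x hx h ih =>
    refine ih.trans (SimpleGraph.Adj.reachable ?_)
    rw [SimpleGraph.induce_adj, cycleGraph_adj_iff hm]
    exact Or.inr (sub_add_cancel x 1).symm

theorem run_of_reachable (hm : 4 ≤ m) {S : Finset (Fin m)} {d : Fin m} (hd : d ∈ firsts S)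
    {x y : (S : Set (Fin m))}
    (hxy : ((SimpleGraph.cycleGraph m).induce (S : Set (Fin m))).Reachable x y)
    (hx : Run S d x) : Run S d y := by
  obtain ⟨w⟩ := hxy
  induction w with
  | nil => exact hx
  | @cons u v w huv _ ih =>
    apply ih
    rw [SimpleGraph.induce_adj, cycleGraph_adj_iff hm] at huv
    have hvS : (v : Fin m) ∈ S := v.2
    rcases huv with h | h
    · have hv : (u : Fin m) - 1 = v := by rw [h, add_sub_cancel_right]
      rw [← hv]
      exact hx.of_sub_one_mem hd (by rwa [hv])
    · refine .step _ v.2 ?_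
      rwa [h, add_sub_cancel_right]

/-- The connected components are the runs. -/
theorem arc_eq_component (hm : 4 ≤ m) {S : Finset (Fin m)} {d : Fin m} (hd : d ∈ firsts S)
    (x : (S : Set (Fin m))) (hx : Run S d x) :
    (arc S d : Set (Fin m)) = Subtype.val '' (((SimpleGraph.cycleGraph m).induce
      (S : Set (Fin m))).connectedComponentMk x).supp := by
  have hdS := (mem_firsts.1 hd).1
  ext y
  simp only [Finset.mem_coe, mem_arc, Set.mem_image, SimpleGraph.ConnectedComponent.mem_supp_iff,
    SimpleGraph.ConnectedComponent.eq]
  constructor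
  · intro h
    exact ⟨⟨y, h.mem⟩, (reachable_of_run hm h hdS).symm.trans (reachable_of_run hm hx hdS), rfl⟩
  · rintro ⟨z, hz, rfl⟩
    exact run_of_reachable hm hd hz.symm hx

theorem exists_eq_arc_of_isArc (hm : 4 ≤ m) {S a : Finset (Fin m)} (hS : S ≠ Finset.univ)
    (ha : IsArc S a) : ∃ d ∈ firsts S, a = arc S d := by
  obtain ⟨-, c, hc⟩ := ha
  induction c using SimpleGraph.ConnectedComponent.ind with
  | _ x =>
    obtain ⟨d, hd, h⟩ := exists_run hS x.2
    refine ⟨d, hd, Finset.coe_injective ?_⟩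
    rw [hc, arc_eq_component hm hd x h]

theorem isArc_arc (hm : 4 ≤ m) {S : Finset (Fin m)} (hS : ∀ x ∈ S, x - 1 ∈ S ∨ x + 1 ∈ S)
    {d : Fin m} (hd : d ∈ firsts S) : IsArc S (arc S d) := by
  have hdS := mem_firsts.1 hd
  have h1 : d + 1 ∈ S := (hS d hdS.1).resolve_left hdS.2
  refine ⟨?_, _, arc_eq_component hm hd ⟨d, hdS.1⟩ (.refl hdS.1)⟩
  have hne := (one_ne_zero_fin hm).1
  have hpair : ({d, d + 1} : Finset (Fin m)).card = 2 := Finset.card_pair (by simpa using hne.symm)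
  rw [← hpair]
  refine Finset.card_le_card fun x hx => mem_arc.2 ?_
  rcases Finset.mem_insert.1 hx with rfl | hx
  · exact .refl hdS.1
  · rw [Finset.mem_singleton.1 hx]
    refine .step _ h1 ?_
    rw [add_sub_cancel_right]
    exact .refl hdS.1

/-- The arc picture consisting of all arcs of an admissible set. -/
def Admissible.picture (hm : 4 ≤ m) {S : Finset (Fin m)} (hS : Admissible t S) :
    ArcPicture m t where
  S := S
  A := (firsts S).image (arc S)
  proper := hS.ne_univ
  isArc := by
    intro a ha
    obtain ⟨d, hd, rfl⟩ := Finset.mem_image.1 ha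
    exact isArc_arc hm hS.not_isolated hd
  card_eq := by rw [Finset.card_image_of_injOn (arc_injOn S), hS.card_firsts]

theorem ArcPicture.first_eq (P : ArcPicture m t) (hP : P.A = (firsts P.S).image (arc P.S)) :
    P.first = firsts P.S := by
  ext x
  simp only [ArcPicture.first, hP, Finset.mem_filter, Finset.mem_univ, true_and,
    Finset.exists_mem_image, mem_arc]
  constructor
  · rintro ⟨d, hd, h, h'⟩
    exact mem_firsts.2 ⟨h.mem, fun hx => h' (h.of_sub_one_mem hd hx)⟩
  · intro hx
    have hx' := mem_firsts.1 hx
    exact ⟨x, hx, .refl hx'.1, fun h => hx'.2 h.mem⟩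

theorem Admissible.hat_picture (hm : 4 ≤ m) {S : Finset (Fin m)} (hS : Admissible t S) :
    (hS.picture hm).hat = Finset.univ := by
  have key : ∀ y ∈ S, ∃ d ∈ firsts S, y ∈ arc S d := fun y hy => by
    obtain ⟨d, hd, h⟩ := exists_run hS.ne_univ hy
    exact ⟨d, hd, mem_arc.2 h⟩
  ext x
  simp only [ArcPicture.hat, Admissible.picture, Finset.mem_filter, Finset.mem_univ, true_and,
    Finset.exists_mem_image, iff_true]
  have := hS.gap (x - 1)
  rw [sub_add_cancel] at this
  rcases this with h | h | h
  · obtain ⟨d, hd, h⟩ := key _ h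
    exact ⟨d, hd, Or.inr (Or.inr h)⟩
  · obtain ⟨d, hd, h⟩ := key _ h
    exact ⟨d, hd, Or.inl h⟩
  · obtain ⟨d, hd, h⟩ := key _ h
    exact ⟨d, hd, Or.inr (Or.inl h)⟩

/-- If the enlarged arcs of `A` cover the cycle then `A` consists of all components. -/
theorem ArcPicture.admissible_of_hat (hm : 4 ≤ m) (P : ArcPicture m t)
    (hP : P.hat = Finset.univ) :
    Admissible t P.S ∧ P.A = (firsts P.S).image (arc P.S) := by
  have harc : ∀ a ∈ P.A, ∃ d ∈ firsts P.S, a = arc P.S d := fun a ha =>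
    exists_eq_arc_of_isArc hm P.proper (P.isArc a ha)
  have hhat : ∀ x, ∃ d ∈ firsts P.S, arc P.S d ∈ P.A ∧
      (Run P.S d x ∨ Run P.S d (x + 1) ∨ Run P.S d (x - 1)) := by
    intro x
    have hx : x ∈ P.hat := hP ▸ Finset.mem_univ x
    obtain ⟨a, ha, h⟩ := (Finset.mem_filter.1 hx).2
    obtain ⟨d, hd, rfl⟩ := harc a ha
    simp only [mem_arc] at h
    exact ⟨d, hd, ha, h⟩
  have hmem : ∀ x ∈ P.S, ∃ d ∈ firsts P.S, arc P.S d ∈ P.A ∧ Run P.S d x := by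
    intro x hx
    obtain ⟨d, hd, ha, h | h | h⟩ := hhat x
    · exact ⟨d, hd, ha, h⟩
    · refine ⟨d, hd, ha, ?_⟩
      have := h.of_sub_one_mem hd
      rw [add_sub_cancel_right] at this
      exact this hx
    · exact ⟨d, hd, ha, .step x hx h⟩
  have hA : P.A = (firsts P.S).image (arc P.S) := by
    ext a
    rw [Finset.mem_image]
    constructor
    · intro ha
      obtain ⟨d, hd, rfl⟩ := harc a ha
      exact ⟨d, hd, rfl⟩
    · rintro ⟨d, hd, rfl⟩
      have hdS := (mem_firsts.1 hd).1
      obtain ⟨d', hd', ha', h'⟩ := hmem d hdS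
      rwa [(Run.refl hdS).unique h' hd hd']
  refine ⟨⟨P.proper, ?_, ?_, ?_⟩, hA⟩
  · intro x hx
    by_contra! hno
    have hxf : x ∈ firsts P.S := mem_firsts.2 ⟨hx, hno.1⟩
    have h2 := (P.isArc (arc P.S x) (hA ▸ Finset.mem_image_of_mem _ hxf)).1
    obtain ⟨y, hy, hyx⟩ := Finset.exists_mem_ne (s := arc P.S x) (by omega) x
    exact hno.2 ((mem_arc.1 hy).add_one_mem hyx)
  · intro x
    obtain ⟨d, -, -, h | h | h⟩ := hhat (x + 1)
    · exact Or.inr (Or.inl h.mem)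
    · exact Or.inr (Or.inr h.mem)
    · have := h.mem
      rw [add_sub_cancel_right] at this
      exact Or.inl this
  · have := P.card_eq
    rwa [hA, Finset.card_image_of_injOn (arc_injOn P.S)] at this

end Cycle

/-! ### Cubes and their complements -/

section Cubes

variable {m t : ℕ} [NeZero m]

theorem circDist_eq_one_iff (hm : 4 ≤ m) {x y : Fin m} :
    circDist x y = 1 ↔ x = y + 1 ∨ y = x + 1 := by
  obtain ⟨h1, -⟩ := val_eq_one_two hm
  have e1 : ∀ u v : Fin m, u = v + 1 ↔ (u - v).val = 1 := fun u v => by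
    rw [← h1, ← Fin.ext_iff, sub_eq_iff_eq_add']
  have e0 : ∀ u v : Fin m, u = v ↔ (u - v).val = 0 := fun u v => by
    rw [Fin.val_eq_zero_iff, sub_eq_zero]
  rw [e1, e1, circDist]
  have h0 : (x - y).val = 0 ↔ (y - x).val = 0 := by rw [← e0, ← e0, eq_comm]
  omega

theorem circDist_lt_three_iff (hm : 4 ≤ m) {x y : Fin m} :
    circDist x y < 3 ↔ x = y ∨ x = y + 1 ∨ x = y + 1 + 1 ∨ y = x + 1 ∨ y = x + 1 + 1 := by
  obtain ⟨h1, h2⟩ := val_eq_one_two hm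
  have e1 : ∀ u v : Fin m, u = v + 1 ↔ (u - v).val = 1 := fun u v => by
    rw [← h1, ← Fin.ext_iff, sub_eq_iff_eq_add']
  have e2 : ∀ u v : Fin m, u = v + 1 + 1 ↔ (u - v).val = 2 := fun u v => by
    rw [← h2, ← Fin.ext_iff, sub_eq_iff_eq_add', add_assoc]
  have e0 : ∀ u v : Fin m, u = v ↔ (u - v).val = 0 := fun u v => by
    rw [Fin.val_eq_zero_iff, sub_eq_zero]
  have h0 : (x - y).val = 0 ↔ (y - x).val = 0 := by rw [← e0, ← e0, eq_comm]
  rw [e2, e2, e1, e1, e0, circDist]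
  omega

namespace PhiCube

/-- The set of the points covered by a cube. -/
def points (c : PhiCube t m 3) : Finset (Fin m) := c.sets.biUnion id

theorem mem_points {c : PhiCube t m 3} {x : Fin m} : x ∈ c.points ↔ ∃ s ∈ c.sets, x ∈ s := by
  simp [points]

theorem nonempty_of_mem (c : PhiCube t m 3) {s : Finset (Fin m)} (hs : s ∈ c.sets) :
    s.Nonempty := by
  rcases c.shape s hs with ⟨x, rfl⟩ | ⟨x, y, -, rfl⟩ <;> simp

/-- Nearby points of a cube are in the same set. -/
theorem eq_of_near (hm : 4 ≤ m) (c : PhiCube t m 3) {s s' : Finset (Fin m)} (hs : s ∈ c.sets)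
    (hs' : s' ∈ c.sets) {x y : Fin m} (hx : x ∈ s) (hy : y ∈ s')
    (h : x = y ∨ x = y + 1 ∨ x = y + 1 + 1 ∨ y = x + 1 ∨ y = x + 1 + 1) : s = s' := by
  by_contra hne
  have h1 := c.separated s hs s' hs' hne x hx y hy
  have h2 := (circDist_lt_three_iff hm).2 h
  omega

theorem near_of_mem (hm : 4 ≤ m) (c : PhiCube t m 3) {s : Finset (Fin m)} (hs : s ∈ c.sets)
    {x y : Fin m} (hx : x ∈ s) (hy : y ∈ s) : x = y ∨ x = y + 1 ∨ y = x + 1 := by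
  rcases c.shape s hs with ⟨z, rfl⟩ | ⟨z, w, h, rfl⟩
  · left; simp_all
  · rw [circDist_eq_one_iff hm] at h
    simp only [Finset.mem_insert, Finset.mem_singleton] at hx hy
    rcases hx with rfl | rfl <;> rcases hy with rfl | rfl <;> tauto

/-- Each set of a cube has a last element. -/
theorem exists_last (hm : 4 ≤ m) (c : PhiCube t m 3) {s : Finset (Fin m)} (hs : s ∈ c.sets) :
    ∃ x ∈ s, x + 1 ∉ s := by
  obtain ⟨x, hx⟩ := c.nonempty_of_mem hs
  by_cases h : x + 1 ∈ s
  · refine ⟨x + 1, h, fun h' => ?_⟩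
    have h1 := add_one_ne_self hm x
    have h2 := add_one_ne_self hm (x + 1)
    have := c.near_of_mem hm hs hx h'
    grind
  · exact ⟨x, hx, h⟩

theorem admissible_compl_points (hm : 4 ≤ m) (ht : 1 ≤ t) (c : PhiCube t m 3) :
    Admissible t c.pointsᶜ := by
  have h1 := add_one_ne_self hm
  refine ⟨?_, ?_, ?_, ?_⟩
  · obtain ⟨s, hs⟩ := Finset.card_pos.1 (c.card_eq ▸ ht)
    obtain ⟨x, hx⟩ := c.nonempty_of_mem hs
    intro h
    have : x ∈ c.pointsᶜ := h ▸ Finset.mem_univ x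
    exact Finset.mem_compl.1 this (mem_points.2 ⟨s, hs, hx⟩)
  · intro x _
    obtain ⟨x, rfl⟩ : ∃ y, x = y + 1 := ⟨x - 1, (sub_add_cancel x 1).symm⟩
    by_contra! hno
    simp only [add_sub_cancel_right, Finset.mem_compl, not_not, mem_points] at hno
    obtain ⟨⟨s, hs, hxs⟩, s', hs', hxs'⟩ := hno
    have h := c.eq_of_near hm hs hs' hxs hxs' (by grind)
    subst h
    have := c.near_of_mem hm hs hxs hxs'
    have h2 := h1 (x + 1)
    have h1 := h1 x
    grind
  · intro x
    by_contra! hno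
    simp only [Finset.mem_compl, not_not, mem_points] at hno
    obtain ⟨⟨s, hs, hxs⟩, ⟨s', hs', hxs'⟩, s'', hs'', hxs''⟩ := hno
    have h := c.eq_of_near hm hs hs'' hxs hxs'' (by grind)
    subst h
    have := c.near_of_mem hm hs hxs hxs''
    have h2 := h1 (x + 1)
    have h1 := h1 x
    grind
  · refine Eq.trans (Eq.symm ?_) c.card_eq
    have hlast : ∀ s ∈ c.sets, ∃ x ∈ s, x + 1 ∉ s := fun s hs => c.exists_last hm hs
    choose! l hl hl' using hlast
    refine Finset.card_bij (fun s _ => l s + 1) ?_ ?_ ?_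
    · intro s hs
      rw [mem_firsts, add_sub_cancel_right, Finset.mem_compl, Finset.mem_compl, not_not,
        mem_points, mem_points]
      refine ⟨?_, s, hs, hl s hs⟩
      rintro ⟨s', hs', h⟩
      rw [← c.eq_of_near hm hs hs' (hl s hs) h (by grind)] at h
      exact hl' s hs h
    · intro s hs s' hs' h
      exact c.eq_of_near hm hs hs' (hl s hs) (hl s' hs') (Or.inl (add_right_cancel h))
    · intro d hd
      rw [mem_firsts, Finset.mem_compl, Finset.mem_compl, not_not, mem_points, mem_points] at hd
      obtain ⟨hd1, s, hs, hds⟩ := hd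
      refine ⟨s, hs, ?_⟩
      have h1 : d ∉ s := fun h => hd1 ⟨s, hs, h⟩
      have h2 := hl s hs
      have h3 := hl' s hs
      have h4 := c.near_of_mem hm hs hds h2
      grind

theorem card_compl_points (hm : 4 ≤ m) (c : PhiCube t m 3) :
    (c.pointsᶜ.card : ℤ) = m - t - c.dim := by
  have h1 : c.points.card = ∑ s ∈ c.sets, s.card := by
    refine Finset.card_biUnion fun s hs s' hs' hne => Finset.disjoint_left.2 fun x hx hx' => ?_
    exact hne (c.eq_of_near hm hs hs' hx hx' (Or.inl rfl))
  have h2 : ∑ s ∈ c.sets, s.card = t + c.dim := by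
    have hsum : ∑ s ∈ c.sets, s.card = c.sets.card + c.dim := by
      rw [PhiCube.dim, Finset.card_filter, Finset.card_eq_sum_ones, ← Finset.sum_add_distrib]
      refine Finset.sum_congr rfl fun s hs => ?_
      rcases c.shape s hs with ⟨x, rfl⟩ | ⟨x, y, h, rfl⟩
      · simp
      · rw [circDist_eq_one_iff hm] at h
        have hx := add_one_ne_self hm x
        have hy := add_one_ne_self hm y
        have : x ≠ y := by grind
        simp [Finset.card_pair this]
    rw [hsum, c.card_eq]
  have h3 := Finset.card_add_card_compl c.points
  rw [Fintype.card_fin] at h3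
  omega

/-- For cubes, being a face means covering fewer points. -/
theorem isFace_iff (hm : 4 ≤ m) {c' c : PhiCube t m 3} : c'.IsFace c ↔ c'.points ⊆ c.points := by
  constructor
  · intro h x hx
    choose! f hf hf' using h
    obtain ⟨s', hs', hxs'⟩ := mem_points.1 hx
    have hinj : Set.InjOn f c.sets := by
      intro s hs u hu hsu
      obtain ⟨y, hy⟩ := c'.nonempty_of_mem (hf s hs)
      exact c.eq_of_near hm hs hu (hf' s hs hy) (hf' u hu (hsu ▸ hy)) (Or.inl rfl)
    obtain ⟨s, hs, rfl⟩ := Finset.surj_on_of_inj_on_of_card_le (fun s _ => f s) hf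
      (fun a b ha hb hab => hinj ha hb hab) (by rw [c.card_eq, c'.card_eq]) s' hs'
    exact mem_points.2 ⟨s, hs, hf' s hs hxs'⟩
  · intro h
    have hsub : ∀ s' ∈ c'.sets, ∃ s ∈ c.sets, s' ⊆ s := by
      intro s' hs'
      obtain ⟨x, hx⟩ := c'.nonempty_of_mem hs'
      obtain ⟨s, hs, hxs⟩ := mem_points.1 (h (mem_points.2 ⟨s', hs', hx⟩))
      refine ⟨s, hs, fun y hy => ?_⟩
      obtain ⟨u, hu, hyu⟩ := mem_points.1 (h (mem_points.2 ⟨s', hs', hy⟩))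
      have := c'.near_of_mem hm hs' hx hy
      rwa [c.eq_of_near hm hs hu hxs hyu (by tauto)]
    choose! f hf hf' using hsub
    intro s hs
    have hinj : Set.InjOn f c'.sets := by
      intro s' hs' u' hu' hsu
      obtain ⟨y, hy⟩ := c'.nonempty_of_mem hs'
      obtain ⟨z, hz⟩ := c'.nonempty_of_mem hu'
      have := c.near_of_mem hm (hf s' hs') (hf' s' hs' hy) (hsu ▸ hf' u' hu' hz)
      exact c'.eq_of_near hm hs' hu' hy hz (by tauto)
    obtain ⟨s', hs', rfl⟩ := Finset.surj_on_of_inj_on_of_card_le (fun s _ => f s) hf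
      (fun a b ha hb hab => hinj ha hb hab) (by rw [c.card_eq, c'.card_eq]) s hs
    exact ⟨s', hs', hf' s' hs'⟩

theorem points_injective (hm : 4 ≤ m) : Function.Injective (points : PhiCube t m 3 → _) := by
  have key : ∀ c c' : PhiCube t m 3, c.points = c'.points → c.sets ⊆ c'.sets := by
    intro c c' h s hs
    obtain ⟨u, hu, hus⟩ := (isFace_iff hm (c' := c') (c := c)).2 h.ge s hs
    obtain ⟨v, hv, hvu⟩ := (isFace_iff hm (c' := c) (c := c')).2 h.le u hu
    obtain ⟨x, hx⟩ := c.nonempty_of_mem hv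
    have := c.eq_of_near hm hv hs hx (hus (hvu hx)) (Or.inl rfl)
    rw [this] at hvu
    rwa [Finset.Subset.antisymm hvu hus]
  intro c c' h
  have := Finset.Subset.antisymm (key c c' h) (key c' c h.symm)
  cases c; cases c'; simpa using this

end PhiCube

/-- The gap of `S` which ends right before `d`, provided that gaps have at most two elements. -/
def gapBefore (S : Finset (Fin m)) (d : Fin m) : Finset (Fin m) :=
  Finset.univ.filter fun x => x = d - 1 ∨ (x = d - 1 - 1 ∧ x ∉ S)

theorem mem_gapBefore {S : Finset (Fin m)} {d x : Fin m} :
    x ∈ gapBefore S d ↔ x = d - 1 ∨ (x = d - 1 - 1 ∧ x ∉ S) := by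
  simp [gapBefore]

/-- Elements of gaps at distance at most two belong to the same gap. -/
theorem Admissible.eq_of_near {S : Finset (Fin m)} (hS : Admissible t S) {d d' x y : Fin m}
    (hd : d ∈ firsts S) (hd' : d' ∈ firsts S) (hx : x ∈ gapBefore S d) (hy : y ∈ gapBefore S d')
    (h : x = y ∨ x = y + 1 ∨ x = y + 1 + 1 ∨ y = x + 1 ∨ y = x + 1 + 1) : d = d' := by
  -- `d` is the first element of `S` after `x`
  have key : ∀ d x, d ∈ firsts S → x ∈ gapBefore S d →
      d ∈ S ∧ x ∉ S ∧ (x + 1 = d ∨ (x + 1 ∉ S ∧ x + 1 + 1 = d)) := by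
    intro d x hd hx
    rw [mem_firsts] at hd
    rcases mem_gapBefore.1 hx with rfl | ⟨rfl, h⟩
    · exact ⟨hd.1, hd.2, Or.inl (by grind)⟩
    · exact ⟨hd.1, h, Or.inr ⟨by simpa using hd.2, by grind⟩⟩
  have main : ∀ x y d d', d ∈ firsts S → d' ∈ firsts S → x ∈ gapBefore S d →
      y ∈ gapBefore S d' → (x = y ∨ y = x + 1 ∨ y = x + 1 + 1) → d = d' := by
    intro x y d d' hd hd' hx hy h
    obtain ⟨h1, h2, h3⟩ := key d x hd hx
    obtain ⟨h1', h2', h3'⟩ := key d' y hd' hy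
    rcases h with rfl | rfl | rfl
    · grind
    · grind
    · have h4 := hS.gap x
      have h5 := hS.not_isolated (x + 1)
      rw [add_sub_cancel_right] at h5
      grind
  rcases h with h | h | h | h | h
  · exact main x y d d' hd hd' hx hy (Or.inl h)
  · exact (main y x d' d hd' hd hy hx (Or.inr (Or.inl h))).symm
  · exact (main y x d' d hd' hd hy hx (Or.inr (Or.inr h))).symm
  · exact main x y d d' hd hd' hx hy (Or.inr (Or.inl h))
  · exact main x y d d' hd hd' hx hy (Or.inr (Or.inr h))

/-- The cube formed by the gaps of an admissible set. -/
def Admissible.cube (hm : 4 ≤ m) {S : Finset (Fin m)} (hS : Admissible t S) : PhiCube t m 3 where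
  sets := (firsts S).image (gapBefore S)
  card_eq := by
    rw [Finset.card_image_of_injOn, hS.card_firsts]
    intro d hd d' hd' h
    have h1 : d - 1 ∈ gapBefore S d := mem_gapBefore.2 (Or.inl rfl)
    exact hS.eq_of_near hd hd' h1 (h ▸ h1) (Or.inl rfl)
  shape := by
    intro s hs
    obtain ⟨d, hd, rfl⟩ := Finset.mem_image.1 hs
    by_cases h : d - 1 - 1 ∈ S
    · left
      refine ⟨d - 1, ?_⟩
      ext x
      rw [mem_gapBefore, Finset.mem_singleton]
      grind
    · right
      refine ⟨d - 1, d - 1 - 1, (circDist_eq_one_iff hm).2 (Or.inl (by grind)), ?_⟩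
      ext x
      rw [mem_gapBefore, Finset.mem_insert, Finset.mem_singleton]
      grind
  separated := by
    intro s hs s' hs' hne x hx y hy
    obtain ⟨d, hd, rfl⟩ := Finset.mem_image.1 hs
    obtain ⟨d', hd', rfl⟩ := Finset.mem_image.1 hs'
    by_contra! h
    exact hne (by rw [hS.eq_of_near hd hd' hx hy ((circDist_lt_three_iff hm).1 h)])

theorem Admissible.compl_points_cube (hm : 4 ≤ m) {S : Finset (Fin m)} (hS : Admissible t S) :
    (hS.cube hm).pointsᶜ = S := by
  rw [compl_eq_comm]
  ext x
  rw [Finset.mem_compl, PhiCube.mem_points]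
  simp only [Admissible.cube, Finset.exists_mem_image, mem_gapBefore, mem_firsts]
  constructor
  · intro hx
    have := hS.gap x
    by_cases h : x + 1 ∈ S
    · exact ⟨x + 1, ⟨h, by simpa using hx⟩, Or.inl (by simp)⟩
    · exact ⟨x + 1 + 1, ⟨by tauto, by simpa using h⟩, Or.inr ⟨by simp, hx⟩⟩
  · rintro ⟨d, ⟨h1, h2⟩, rfl | ⟨rfl, h⟩⟩
    · exact h2
    · exact h

end Cubes

/-! ### Cycles dual to the generators -/

section Profile
variable {V W : Type} [Fintype V] [Fintype W] [DecidableEq V] [DecidableEq W]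
  {T : SimpleGraph V}

theorem isFacet_iff_exists_insert {r s : HomPlus T (⊤ : SimpleGraph W)} :
    IsFacet r s ↔ ∃ v, ∃ a ∈ (r.fiber v)ᶜ,
      s.fiber = Function.update r.fiber v (insert a (r.fiber v)) := by
  rw [isFacet_iff_exists_erase]
  constructor
  · rintro ⟨v, a, ha, h⟩
    refine ⟨v, a, by simp [h], ?_⟩
    rw [h, Function.update_self, Finset.insert_erase ha, Function.update_idem,
      Function.update_eq_self]
  · rintro ⟨v, a, ha, h⟩
    refine ⟨v, a, by simp [h], ?_⟩
    rw [h, Function.update_self, Finset.erase_insert (Finset.mem_compl.1 ha), Function.update_idem,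
      Function.update_eq_self]

open Classical in
/-- Summing a function of the color sets over the simplices having the facet `r`. -/
theorem sum_isFacet_fiber (f : (V → Finset W) → ZMod 2)
    (hf : ∀ g, f g ≠ 0 → ∀ v w, T.Adj v w → Disjoint (g v) (g w))
    (r : HomPlus T (⊤ : SimpleGraph W)) :
    (∑ s : HomPlus T (⊤ : SimpleGraph W), if IsFacet r s then f s.fiber else 0) =
      ∑ v, ∑ a ∈ (r.fiber v)ᶜ, f (Function.update r.fiber v (insert a (r.fiber v))) := by
  rw [← Finset.sum_filter, Finset.sum_sigma']
  symm
  have key : ∀ u ∈ Finset.univ.sigma (fun v => (r.fiber v)ᶜ),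
      f (Function.update r.fiber u.1 (insert u.2 (r.fiber u.1))) ≠ 0 →
      ∃ s : HomPlus T (⊤ : SimpleGraph W),
        s.fiber = Function.update r.fiber u.1 (insert u.2 (r.fiber u.1)) := by
    rintro ⟨v, a⟩ _ hne
    exact ⟨HomPlus.ofFiber _ ⟨v, by simp⟩ (hf _ hne), HomPlus.fiber_ofFiber _ _ _⟩
  have : Nonempty (HomPlus T (⊤ : SimpleGraph W)) := ⟨r⟩
  choose! i hi using key
  refine Finset.sum_bij_ne_zero (fun u _ _ => i u) ?_ ?_ ?_ ?_
  · intro u hu hne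
    exact Finset.mem_filter.2 ⟨Finset.mem_univ _,
      isFacet_iff_exists_insert.2 ⟨u.1, u.2, (Finset.mem_sigma.1 hu).2, hi u hu hne⟩⟩
  · rintro ⟨v, a⟩ hu hne ⟨v', a'⟩ hu' hne' h
    have ha := Finset.mem_compl.1 (Finset.mem_sigma.1 hu).2
    have h1 := hi _ hu hne
    rw [h, hi _ hu' hne'] at h1
    have h2 := congrFun h1 v
    simp only [Function.update_self] at h2
    have hv : v = v' := by
      by_contra hvv
      rw [Function.update_of_ne hvv] at h2
      exact ha (h2 ▸ Finset.mem_insert_self _ _)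
    subst hv
    rw [Function.update_self] at h2
    have h3 : a ∈ insert a' (r.fiber v) := h2 ▸ Finset.mem_insert_self _ _
    rcases Finset.mem_insert.1 h3 with rfl | h3
    · rfl
    · exact absurd h3 ha
  · intro s hs hne
    obtain ⟨v, a, ha, hs⟩ := isFacet_iff_exists_insert.1 (Finset.mem_filter.1 hs).2
    have hu : (⟨v, a⟩ : Σ _ : V, W) ∈ Finset.univ.sigma (fun v => (r.fiber v)ᶜ) := by
      simpa using ha
    have hne' : f (Function.update r.fiber v (insert a (r.fiber v))) ≠ 0 := hs ▸ hne
    exact ⟨_, hu, hne', HomPlus.ext_fiber ((hi _ hu hne').trans hs.symm)⟩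
  · intro u hu hne
    rw [hi u hu hne]

end Profile

section Dual

variable {m n : ℕ} [NeZero m]

open Classical in
/-- `Z` is (the indicator of) a cycle of the chain complex of colorings with support `S`, and it
contains exactly one simplex conforming to the profile with all colors but `z` at the first
vertices. The color families are not required to be simplices in the evenness condition. -/
structure IsDualCycle (S : Finset (Fin m)) (z : Fin n) (Z : (Fin m → Finset (Fin n)) → Prop) :
    Prop where
  supp : ∀ g, Z g → ∀ v, (g v).Nonempty ↔ v ∈ S
  disjoint : ∀ g, Z g → ∀ v, Disjoint (g v) (g (v + 1))
  even : ∀ r : Fin m → Finset (Fin n), (∀ v, (r v).Nonempty ↔ v ∈ S) →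
    (∑ v, ∑ a, if a ∉ r v ∧ Z (Function.update r v (insert a (r v))) then (1 : ZMod 2) else 0) = 0
  unique : ∃! g, Z g ∧ Conforms S (firsts S) (fun _ => {z}ᶜ) g

/-- The color sets at a first vertex `d` and at `d + 1` are complementary. -/
def OppositeOnEdges (S : Finset (Fin m)) (g : Fin m → Finset (Fin n)) : Prop :=
  (∀ v, (g v).Nonempty ↔ v ∈ S) ∧ ∀ d ∈ firsts S, ∀ a, a ∈ g d ↔ a ∉ g (d + 1)

/-- If all arcs are edges, one takes the product over the edges of the fundamental cycles of the
spheres `Hom(K₂, K_n)`. -/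
theorem isDualCycle_of_edges (hm : 4 ≤ m) (hn : 3 ≤ n) {S : Finset (Fin m)}
    (hS : ∀ x ∈ S, x - 1 ∈ S ∨ x + 1 ∈ S) (hS3 : ∀ x, x ∈ S → x + 1 ∈ S → x + 1 + 1 ∉ S)
    (z : Fin n) :
    IsDualCycle S z (OppositeOnEdges S) := by
  classical
  have hadd : ∀ d ∈ firsts S, d + 1 ∈ S ∧ d + 1 ∉ firsts S := fun d hd => by
    rw [mem_firsts] at hd
    rw [mem_firsts, add_sub_cancel_right]
    exact ⟨(hS d hd.1).resolve_left hd.2, fun h => h.2 hd.1⟩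
  have hsub : ∀ v ∈ S, v ∉ firsts S → v - 1 ∈ firsts S := fun v hv hvf => by
    have h1 : v - 1 ∈ S := by
      by_contra h
      exact hvf (mem_firsts.2 ⟨hv, h⟩)
    refine mem_firsts.2 ⟨h1, fun h2 => ?_⟩
    have h3 := hS3 _ h2
    rw [sub_add_cancel, sub_add_cancel] at h3
    exact h3 h1 hv
  refine ⟨fun g hg => hg.1, ?_, ?_, ?_⟩
  · rintro g ⟨hg, hg'⟩ v
    by_cases hv : v ∈ firsts S
    · rw [Finset.disjoint_left]
      exact fun a ha => (hg' v hv a).1 ha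
    · by_cases hvS : v ∈ S
      · have h1 := hsub v hvS hv
        have h2 := hS3 _ (mem_firsts.1 h1).1
        rw [sub_add_cancel] at h2
        have h3 : g (v + 1) = ∅ := by
          rw [← Finset.not_nonempty_iff_eq_empty, hg]
          exact h2 hvS
        rw [h3]
        exact Finset.disjoint_empty_right _
      · have h3 : g v = ∅ := by
          rw [← Finset.not_nonempty_iff_eq_empty, hg]
          exact hvS
        rw [h3]
        exact Finset.disjoint_empty_left _
  · intro r hr
    set f : Fin m → ZMod 2 := fun v => ∑ a, if a ∉ r v ∧
      OppositeOnEdges S (Function.update r v (insert a (r v))) then (1 : ZMod 2) else 0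
    change ∑ v, f v = 0
    have h0 : ∀ v, v ∉ S → f v = 0 := by
      intro v hv
      refine Finset.sum_eq_zero fun a _ => if_neg fun h => hv ?_
      rw [← h.2.1 v, Function.update_self]
      exact Finset.insert_nonempty _ _
    have h1 : ∀ d ∈ firsts S, f (d + 1) = f d := by
      intro d hd
      refine Finset.sum_congr rfl fun a _ => if_congr ?_ rfl rfl
      have hd1 := add_one_ne_self hm d
      have hdS := (mem_firsts.1 hd).1
      have hd2 := hadd d hd
      have hsupp : ∀ v ∈ S, ∀ w, (Function.update r v (insert a (r v)) w).Nonempty ↔ w ∈ S := by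
        intro v hv w
        by_cases hwv : w = v
        · subst hwv
          simp [hv]
        · rw [Function.update_of_ne hwv, hr]
      have hother : ∀ d' ∈ firsts S, d' ≠ d →
          d' ≠ d + 1 ∧ d' + 1 ≠ d ∧ d' + 1 ≠ d + 1 := by
        intro d' hd' hne
        refine ⟨fun h => hd2.2 (h ▸ hd'), fun h => ?_, fun h => hne (add_right_cancel h)⟩
        exact (hadd d' hd').2 (h ▸ hd)
      have hcond : ∀ v, v = d ∨ v = d + 1 →
          ((∀ d' ∈ firsts S, ∀ b, b ∈ Function.update r v (insert a (r v)) d' ↔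
            b ∉ Function.update r v (insert a (r v)) (d' + 1)) ↔
          ((∀ b, b ∈ Function.update r v (insert a (r v)) d ↔
            b ∉ Function.update r v (insert a (r v)) (d + 1)) ∧
          ∀ d' ∈ firsts S, d' ≠ d → ∀ b, b ∈ r d' ↔ b ∉ r (d' + 1))) := by
        intro v hv
        constructor
        · intro h
          refine ⟨h d hd, fun d' hd' hne b => ?_⟩
          have := h d' hd' b
          have ho := hother d' hd' hne
          rwa [Function.update_of_ne (by grind), Function.update_of_ne (by grind)] at this
        · rintro ⟨h, h'⟩ d' hd' b
          by_cases hne : d' = d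
          · rw [hne]; exact h b
          · have ho := hother d' hd' hne
            rw [Function.update_of_ne (by grind), Function.update_of_ne (by grind)]
            exact h' d' hd' hne b
      rw [OppositeOnEdges, OppositeOnEdges, hcond _ (Or.inl rfl), hcond _ (Or.inr rfl),
        iff_true_intro (hsupp d hdS), iff_true_intro (hsupp _ hd2.1)]
      simp only [Function.update_self, Function.update_of_ne hd1.1,
        Function.update_of_ne hd1.1.symm, Finset.mem_insert, true_and, ← and_assoc]
      refine and_congr_left fun _ => ⟨?_, ?_⟩
      · rintro ⟨ha, h⟩
        have h1 := h a
        refine ⟨by grind, fun b => ?_⟩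
        have := h b
        grind
      · rintro ⟨ha, h⟩
        have h1 := h a
        refine ⟨by grind, fun b => ?_⟩
        have := h b
        grind
    have hfS : firsts S ⊆ S := Finset.filter_subset _ _
    rw [← Finset.sum_compl_add_sum S, Finset.sum_eq_zero (s := Sᶜ), zero_add,
      ← Finset.sum_sdiff hfS]
    · have h2 : ∑ v ∈ S \ firsts S, f v = ∑ d ∈ firsts S, f d := by
        refine Finset.sum_bij' (fun v _ => v - 1) (fun d _ => d + 1) ?_ ?_ ?_ ?_ ?_
        · intro v hv
          rw [Finset.mem_sdiff] at hv
          exact hsub v hv.1 hv.2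
        · intro d hd
          exact Finset.mem_sdiff.2 (hadd d hd)
        · intro v _
          exact sub_add_cancel _ _
        · intro d _
          exact add_sub_cancel_right _ _
        · intro v hv
          rw [Finset.mem_sdiff] at hv
          rw [← h1 _ (hsub v hv.1 hv.2), sub_add_cancel]
      rw [h2, CharTwo.add_self_eq_zero]
    · intro v hv
      exact h0 v (Finset.mem_compl.1 hv)
  · refine ⟨fun v => if v ∈ firsts S then {z}ᶜ else if v ∈ S then {z} else ∅, ⟨⟨?_, ?_⟩, ?_⟩, ?_⟩
    · intro v
      by_cases hv : v ∈ firsts S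
      · simp only [hv, if_true, (mem_firsts.1 hv).1, iff_true]
        rw [← Finset.card_pos, Finset.card_compl, Finset.card_singleton, Fintype.card_fin]
        omega
      · by_cases hvS : v ∈ S <;> simp [hv, hvS]
    · intro d hd a
      have := hadd d hd
      simp [hd, this.1, this.2]
    · intro v
      by_cases hv : v ∈ firsts S
      · simp only [hv, if_true, (mem_firsts.1 hv).1]
        refine ⟨?_, by simp, by simp⟩
        simp only [iff_true]
        rw [← Finset.card_pos, Finset.card_compl, Finset.card_singleton, Fintype.card_fin]
        omega
      · by_cases hvS : v ∈ S <;> simp [hv, hvS]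
    · rintro g ⟨⟨hg, hg'⟩, hc⟩
      funext v
      by_cases hv : v ∈ firsts S
      · simp only [hv, if_true]
        exact (hc v).2.1 hv
      · by_cases hvS : v ∈ S
        · simp only [hv, hvS, if_true, if_false]
          have h1 := hsub v hvS hv
          have h2 := hg' _ h1
          rw [(hc _).2.1 h1, sub_add_cancel] at h2
          ext a
          have := h2 a
          rw [Finset.mem_compl] at this
          tauto
        · simp only [hv, hvS, if_false]
          rw [← Finset.not_nonempty_iff_eq_empty, hg]
          exact hvS

end Dual

/-! ### Extending dual cycles along an arc -/

section Dual

variable {m n : ℕ} [NeZero m]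

/-- The largest element of `A` is the smallest element of `B`. -/
def MaxEqMin (A B : Finset (Fin n)) : Prop :=
  ∃ p ∈ A, p ∈ B ∧ (∀ a ∈ A, a ≤ p) ∧ ∀ b ∈ B, p ≤ b

theorem maxEqMin_iff {A B : Finset (Fin n)} {p q : Fin n} (hp : p ∈ A) (hp' : ∀ a ∈ A, a ≤ p)
    (hq : q ∈ B) (hq' : ∀ b ∈ B, q ≤ b) : MaxEqMin A B ↔ p = q := by
  constructor
  · rintro ⟨s, hsA, hsB, h1, h2⟩
    exact le_antisymm ((h1 p hp).trans (h2 q hq)) ((hq' s hsB).trans (hp' s hsA))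
  · rintro rfl
    exact ⟨p, hp, hq, hp', hq'⟩

theorem maxEqMin_insert_left {A B : Finset (Fin n)} {p q a : Fin n} (hp : p ∈ A)
    (hp' : ∀ a ∈ A, a ≤ p) (hq : q ∈ B) (hq' : ∀ b ∈ B, q ≤ b) (ha : a ∉ A) :
    MaxEqMin (insert a A) B ↔ (a = q ∧ p < q) ∨ (p = q ∧ a < p) := by
  have hap : a ≠ p := fun h => ha (h ▸ hp)
  rcases lt_or_gt_of_ne hap with h | h
  · rw [maxEqMin_iff (p := p) (Finset.mem_insert_of_mem hp) ?_ hq hq']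
    · constructor
      · intro hpq
        exact Or.inr ⟨hpq, h⟩
      · rintro (⟨rfl, h'⟩ | h')
        · exact absurd h' (not_lt.2 h.le)
        · exact h'.1
    · intro b hb
      rcases Finset.mem_insert.1 hb with rfl | hb
      · exact h.le
      · exact hp' b hb
  · rw [maxEqMin_iff (p := a) (Finset.mem_insert_self _ _) ?_ hq hq']
    · constructor
      · rintro rfl
        exact Or.inl ⟨rfl, h⟩
      · rintro (h' | h')
        · exact h'.1
        · exact absurd h'.2 (not_lt.2 h.le)
    · intro b hb
      rcases Finset.mem_insert.1 hb with rfl | hb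
      · exact le_rfl
      · exact (hp' b hb).trans h.le

theorem maxEqMin_insert_right {A B : Finset (Fin n)} {p q a : Fin n} (hp : p ∈ A)
    (hp' : ∀ a ∈ A, a ≤ p) (hq : q ∈ B) (hq' : ∀ b ∈ B, q ≤ b) (ha : a ∉ B) :
    MaxEqMin A (insert a B) ↔ (a = p ∧ p < q) ∨ (p = q ∧ p < a) := by
  have haq : a ≠ q := fun h => ha (h ▸ hq)
  rcases lt_or_gt_of_ne haq with h | h
  · rw [maxEqMin_iff (q := a) hp hp' (Finset.mem_insert_self _ _) ?_]
    · constructor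
      · rintro rfl
        exact Or.inl ⟨rfl, h⟩
      · rintro (h' | h')
        · exact h'.1.symm
        · exact absurd (h'.1 ▸ h'.2) (not_lt.2 h.le)
    · intro b hb
      rcases Finset.mem_insert.1 hb with rfl | hb
      · exact le_rfl
      · exact h.le.trans (hq' b hb)
  · rw [maxEqMin_iff (q := q) hp hp' (Finset.mem_insert_of_mem hq) ?_]
    · constructor
      · intro hpq
        exact Or.inr ⟨hpq, hpq ▸ h⟩
      · rintro (⟨rfl, h'⟩ | h')
        · exact absurd h' (not_lt.2 h.le)
        · exact h'.1
    · intro b hb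
      rcases Finset.mem_insert.1 hb with rfl | hb
      · exact h.le
      · exact hq' b hb

/-- Move the colors at `w` to `u`. -/
def glue (u w : Fin m) (g : Fin m → Finset (Fin n)) : Fin m → Finset (Fin n) :=
  Function.update (Function.update g w ∅) u (g u ∪ g w)

/-- The image of a chain under the fold of the path which copies the vertex `u` to a new end
vertex `w`: the color set at `u` is split by the Alexander–Whitney diagonal. -/
def Unfold (u w : Fin m) (Z : (Fin m → Finset (Fin n)) → Prop) (g : Fin m → Finset (Fin n)) :
    Prop :=
  Z (glue u w g) ∧ MaxEqMin (g u) (g w)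

theorem glue_self (u w : Fin m) (g : Fin m → Finset (Fin n)) : glue u w g u = g u ∪ g w := by
  simp [glue]

theorem glue_right {u w : Fin m} (huw : u ≠ w) (g : Fin m → Finset (Fin n)) :
    glue u w g w = ∅ := by
  simp [glue, huw.symm]

theorem glue_of_ne {u w v : Fin m} (hu : v ≠ u) (hw : v ≠ w) (g : Fin m → Finset (Fin n)) :
    glue u w g v = g v := by
  simp [glue, hu, hw]

theorem glue_update_of_ne {u w v : Fin m} (hu : v ≠ u) (hw : v ≠ w) (g : Fin m → Finset (Fin n))
    (X : Finset (Fin n)) : glue u w (Function.update g v X) = Function.update (glue u w g) v X := by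
  funext x
  by_cases hxv : x = v
  · subst hxv
    rw [glue_of_ne hu hw, Function.update_self, Function.update_self]
  · rw [Function.update_of_ne hxv]
    simp only [glue, Function.update_apply, hxv, hu.symm, hw.symm, if_false]

theorem glue_insert_left {u w : Fin m} (huw : u ≠ w) (g : Fin m → Finset (Fin n)) (a : Fin n) :
    glue u w (Function.update g u (insert a (g u))) =
      Function.update (glue u w g) u (insert a (glue u w g u)) := by
  funext x
  by_cases hxu : x = u
  · subst hxu
    simp [glue, huw.symm]
  · simp [glue, Function.update_apply, hxu]

theorem glue_insert_right {u w : Fin m} (huw : u ≠ w) (g : Fin m → Finset (Fin n)) (a : Fin n) :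
    glue u w (Function.update g w (insert a (g w))) =
      Function.update (glue u w g) u (insert a (glue u w g u)) := by
  funext x
  by_cases hxu : x = u
  · subst hxu
    simp [glue, huw]
  · simp [glue, Function.update_apply, hxu]

open Classical in
/-- The Alexander–Whitney diagonal is a chain map: adding a color at `u` or `w` to an unfolded
family amounts to adding it at `u` to the glued family. -/
theorem sum_unfold {u w : Fin m} (huw : u ≠ w) (Z : (Fin m → Finset (Fin n)) → Prop)
    (hZ : ∀ g, Z g → g w = ∅) (r : Fin m → Finset (Fin n)) (hu : (r u).Nonempty)
    (hw : (r w).Nonempty)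
    (heven : (∑ v, ∑ a, if a ∉ glue u w r v ∧
      Z (Function.update (glue u w r) v (insert a (glue u w r v))) then (1 : ZMod 2) else 0) = 0) :
    (∑ v, ∑ a, if a ∉ r v ∧ Unfold u w Z (Function.update r v (insert a (r v)))
      then (1 : ZMod 2) else 0) = 0 := by
  set F' : Fin m → ZMod 2 := fun v => ∑ a, if a ∉ glue u w r v ∧
      Z (Function.update (glue u w r) v (insert a (glue u w r v))) then (1 : ZMod 2) else 0 with hF'
  set F : Fin m → ZMod 2 := fun v => ∑ a, if a ∉ r v ∧
      Unfold u w Z (Function.update r v (insert a (r v))) then (1 : ZMod 2) else 0 with hF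
  change ∑ v, F' v = 0 at heven
  change ∑ v, F v = 0
  have hmax := (r u).max'_mem hu
  have hmax' := (r u).le_max'
  have hmin := (r w).min'_mem hw
  have hmin' := (r w).min'_le
  set p := (r u).max' hu
  set q := (r w).min' hw
  have hwu : w ∈ (Finset.univ : Finset (Fin m)).erase u := by simp [huw.symm]
  have hFu : F u = ∑ a, if a ∉ r u ∧ ((a = q ∧ p < q) ∨ (p = q ∧ a < p)) ∧
      Z (Function.update (glue u w r) u (insert a (glue u w r u))) then (1 : ZMod 2) else 0 := by
    refine Finset.sum_congr rfl fun a _ => if_congr ?_ rfl rfl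
    refine and_congr_right fun ha => ?_
    rw [Unfold, glue_insert_left huw, Function.update_self, Function.update_of_ne huw.symm,
      maxEqMin_insert_left hmax hmax' hmin hmin' ha, and_comm]
  have hFw : F w = ∑ a, if a ∉ r w ∧ ((a = p ∧ p < q) ∨ (p = q ∧ p < a)) ∧
      Z (Function.update (glue u w r) u (insert a (glue u w r u))) then (1 : ZMod 2) else 0 := by
    refine Finset.sum_congr rfl fun a _ => if_congr ?_ rfl rfl
    refine and_congr_right fun ha => ?_
    rw [Unfold, glue_insert_right huw, Function.update_self, Function.update_of_ne huw,
      maxEqMin_insert_right hmax hmax' hmin hmin' ha, and_comm]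
  have hFv : ∀ v, v ≠ u → v ≠ w → F v = if p = q then F' v else 0 := by
    intro v hvu hvw
    have h1 : ∀ a, Unfold u w Z (Function.update r v (insert a (r v))) ↔
        p = q ∧ Z (Function.update (glue u w r) v (insert a (glue u w r v))) := by
      intro a
      rw [Unfold, glue_update_of_ne hvu hvw, glue_of_ne hvu hvw, Function.update_of_ne hvu.symm,
        Function.update_of_ne hvw.symm, maxEqMin_iff hmax hmax' hmin hmin', and_comm]
    simp only [hF, hF', h1, glue_of_ne hvu hvw]
    split_ifs with hpq <;> simp [hpq]
  rw [← Finset.add_sum_erase _ _ (Finset.mem_univ u), ← Finset.add_sum_erase _ _ hwu] at heven ⊢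
  by_cases hpq : p = q
  · have hFw' : F' w = 0 := by
      refine Finset.sum_eq_zero fun a _ => if_neg fun h => ?_
      have := hZ _ h.2
      simp at this
    have hsum : F u + F w = F' u := by
      rw [hFu, hFw, ← Finset.sum_add_distrib]
      refine Finset.sum_congr rfl fun a _ => ?_
      rw [glue_self]
      simp only [Finset.mem_union]
      rcases lt_trichotomy a p with h | h | h
      · have haw : a ∉ r w := fun h' => absurd (hmin' a h') (not_le.2 (h.trans_eq hpq))
        simp [← hpq, h, haw, not_lt.2 h.le]
      · simp [← hpq, h, hmax]
      · have hau : a ∉ r u := fun h' => absurd (hmax' a h') (not_le.2 h)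
        simp [← hpq, h, hau, not_lt.2 h.le]
    rw [← add_assoc, hsum, ← heven, hFw', zero_add]
    congr 1
    refine Finset.sum_congr rfl fun v hv => ?_
    simp only [Finset.mem_erase] at hv
    rw [hFv v hv.2.1 hv.1, if_pos hpq]
  · -- `q` can be added at `u`, or `p` at `w`, with the same result after gluing
    rw [Finset.sum_eq_zero, add_zero]
    · have hu' : F u = if p < q ∧ Z (glue u w r) then 1 else 0 := by
        rw [hFu, Finset.sum_eq_single q]
        · have h1 : insert q (glue u w r u) = glue u w r u :=
            Finset.insert_eq_self.2 (by rw [glue_self]; exact Finset.mem_union_right _ hmin)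
          rw [h1, Function.update_eq_self]
          refine if_congr ⟨?_, ?_⟩ rfl rfl
          · rintro ⟨-, h | h, hz⟩
            · exact ⟨h.2, hz⟩
            · exact absurd h.1 hpq
          · rintro ⟨h, hz⟩
            exact ⟨fun h' => absurd (hmax' q h') (not_le.2 h), Or.inl ⟨rfl, h⟩, hz⟩
        · intro a _ ha
          simp [ha, hpq]
        · simp
      have hw' : F w = if p < q ∧ Z (glue u w r) then 1 else 0 := by
        rw [hFw, Finset.sum_eq_single p]
        · have h1 : insert p (glue u w r u) = glue u w r u :=
            Finset.insert_eq_self.2 (by rw [glue_self]; exact Finset.mem_union_left _ hmax)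
          rw [h1, Function.update_eq_self]
          refine if_congr ⟨?_, ?_⟩ rfl rfl
          · rintro ⟨-, h | h, hz⟩
            · exact ⟨h.2, hz⟩
            · exact absurd h.1 hpq
          · rintro ⟨h, hz⟩
            exact ⟨fun h' => absurd (hmin' p h') (not_le.2 h), Or.inl ⟨rfl, h⟩, hz⟩
        · intro a _ ha
          simp [ha, hpq]
        · simp
      rw [hu', hw', CharTwo.add_self_eq_zero]
    · intro v hv
      simp only [Finset.mem_erase] at hv
      rw [hFv v hv.2.1 hv.1, if_neg hpq]

/-- A dual cycle is extended over a new end vertex of an arc with at least three vertices. -/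
theorem IsDualCycle.unfold (hm : 4 ≤ m) {S : Finset (Fin m)} {u : Fin m} (hu : u ∈ S)
    (hu1 : u + 1 ∈ S) (hu2 : u + 1 + 1 ∈ S) (hu3 : u + 1 + 1 + 1 ∉ S) {z : Fin n}
    {Z : (Fin m → Finset (Fin n)) → Prop} (hZ : IsDualCycle (S.erase (u + 1 + 1)) z Z) :
    IsDualCycle S z (Unfold u (u + 1 + 1) Z) := by
  classical
  have hne := add_one_ne_self hm u
  have hne1 := add_one_ne_self hm (u + 1)
  have hne2 := add_one_ne_self hm (u + 1 + 1)
  set w := u + 1 + 1 with hw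
  have huw : u ≠ w := hne.2.1.symm
  have hwf : w ∉ firsts S := by
    rw [mem_firsts, hw, add_sub_cancel_right]
    exact fun h => h.2 hu1
  have hfirsts : firsts (S.erase w) = firsts S := by
    ext x
    rw [mem_firsts, mem_firsts, Finset.mem_erase, Finset.mem_erase]
    constructor
    · rintro ⟨⟨hxw, hx⟩, h⟩
      refine ⟨hx, fun h' => h ⟨fun hx1 => hu3 ?_, h'⟩⟩
      rwa [← hx1, sub_add_cancel]
    · rintro ⟨hx, h⟩
      exact ⟨⟨fun hxw => hwf (hxw ▸ mem_firsts.2 ⟨hx, h⟩), hx⟩, fun h' => h h'.2⟩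
  have hsupp : ∀ g, Unfold u w Z g → ∀ v, (g v).Nonempty ↔ v ∈ S := by
    rintro g ⟨hg, p, hpu, hpw, -⟩ v
    by_cases hvu : v = u
    · rw [hvu]; exact iff_of_true ⟨p, hpu⟩ hu
    by_cases hvw : v = w
    · rw [hvw]; exact iff_of_true ⟨p, hpw⟩ hu2
    have := hZ.supp _ hg v
    rwa [glue_of_ne hvu hvw, Finset.mem_erase, and_iff_right hvw] at this
  refine ⟨hsupp, ?_, ?_, ?_⟩
  · intro g hg v
    have hd := hZ.disjoint _ hg.1
    have h3 : g (w + 1) = ∅ := by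
      rw [← Finset.not_nonempty_iff_eq_empty, hsupp g hg]
      exact hu3
    by_cases hvw : v = w
    · rw [hvw, h3]
      exact Finset.disjoint_empty_right _
    by_cases hvw1 : v + 1 = w
    · have hv : v = u + 1 := add_right_cancel hvw1
      have h1 := hd u
      rw [glue_self, glue_of_ne hne.1 hne1.1.symm, Finset.disjoint_union_left] at h1
      rw [hvw1, hv]
      exact h1.2.symm
    have h1 := hd v
    by_cases hvu : v = u
    · rw [hvu] at h1 hvw1 ⊢
      rw [glue_self, glue_of_ne hne.1 hvw1, Finset.disjoint_union_left] at h1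
      exact h1.1
    by_cases hvu1 : v + 1 = u
    · rw [hvu1] at h1 ⊢
      rw [glue_self, glue_of_ne hvu hvw, Finset.disjoint_union_right] at h1
      exact h1.1
    rwa [glue_of_ne hvu hvw, glue_of_ne hvu1 hvw1] at h1
  · intro r hr
    refine sum_unfold huw Z ?_ r ((hr u).2 hu) ((hr w).2 hu2) (hZ.even _ fun v => ?_)
    · intro g hg
      rw [← Finset.not_nonempty_iff_eq_empty, hZ.supp g hg]
      simp
    · by_cases hvu : v = u
      · rw [hvu, glue_self]
        exact iff_of_true (((hr u).2 hu).mono Finset.subset_union_left)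
          (Finset.mem_erase.2 ⟨huw, hu⟩)
      by_cases hvw : v = w
      · rw [hvw, glue_right huw]
        simp
      rw [glue_of_ne hvu hvw, hr, Finset.mem_erase, and_iff_right hvw]
  · obtain ⟨g₀, ⟨hg₀, hc₀⟩, huniq⟩ := hZ.unique
    have hne₀ : (g₀ u).Nonempty := (hZ.supp _ hg₀ u).2 (Finset.mem_erase.2 ⟨huw, hu⟩)
    have hw₀ : g₀ w = ∅ := by
      rw [← Finset.not_nonempty_iff_eq_empty, hZ.supp _ hg₀]
      simp
    have hglue : glue u w (Function.update g₀ w {(g₀ u).max' hne₀}) = g₀ := by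
      funext x
      by_cases hxu : x = u
      · rw [hxu, glue_self, Function.update_self, Function.update_of_ne huw,
          Finset.union_eq_left, Finset.singleton_subset_iff]
        exact Finset.max'_mem _ _
      by_cases hxw : x = w
      · rw [hxw, glue_right huw, hw₀]
      rw [glue_of_ne hxu hxw, Function.update_of_ne hxw]
    refine ⟨Function.update g₀ w {(g₀ u).max' hne₀}, ⟨⟨by rwa [hglue], ?_⟩, ?_⟩, ?_⟩
    · rw [Function.update_self, Function.update_of_ne huw]
      exact ⟨_, Finset.max'_mem _ _, Finset.mem_singleton_self _, Finset.le_max' _,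
        fun b hb => (Finset.mem_singleton.1 hb).ge⟩
    · rw [conforms_update_iff]
      refine ⟨by simp [hu2, hwf], fun v hv => ?_⟩
      have := hc₀ v
      rwa [hfirsts, Finset.mem_erase, and_iff_right hv] at this
    · rintro g ⟨⟨hg, hmm⟩, hc⟩
      obtain ⟨p, hp⟩ := Finset.card_eq_one.1 ((hc w).2.2 hu2 hwf)
      obtain ⟨p', hpu, hpw, hle, -⟩ := hmm
      have hpp : p' = p := by simpa [hp] using hpw
      subst hpp
      have hgu : glue u w g u = g u := by
        rw [glue_self, hp, Finset.union_eq_left, Finset.singleton_subset_iff]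
        exact hpu
      have hg₁ : glue u w g = g₀ := by
        refine huniq _ ⟨hg, fun v => ?_⟩
        rw [hfirsts]
        by_cases hvw : v = w
        · rw [hvw, glue_right huw]
          simp [hwf]
        have hv : glue u w g v = g v := by
          by_cases hvu : v = u
          · rw [hvu, hgu]
          · exact glue_of_ne hvu hvw g
        rw [hv, Finset.mem_erase, and_iff_right hvw]
        exact hc v
      funext x
      by_cases hxw : x = w
      · have hmax : (g₀ u).max' hne₀ = p' := by
          apply le_antisymm
          · refine Finset.max'_le _ _ _ fun a ha => hle a ?_
            rwa [← hg₁, hgu] at ha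
          · exact Finset.le_max' _ _ (by rw [← hg₁, hgu]; exact hpu)
        rw [hxw, Function.update_self, hp, hmax]
      · rw [Function.update_of_ne hxw, ← hg₁]
        by_cases hxu : x = u
        · rw [hxu, hgu]
        · rw [glue_of_ne hxu hxw]

theorem exists_isDualCycle (hm : 4 ≤ m) (hn : 3 ≤ n) (z : Fin n) (S : Finset (Fin m))
    (hS : S ≠ Finset.univ) (hS' : ∀ x ∈ S, x - 1 ∈ S ∨ x + 1 ∈ S) :
    ∃ Z : (Fin m → Finset (Fin n)) → Prop, IsDualCycle S z Z := by
  induction S using Finset.strongInduction with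
  | H S ih =>
    by_cases h3 : ∀ x, x ∈ S → x + 1 ∈ S → x + 1 + 1 ∉ S
    · exact ⟨_, isDualCycle_of_edges hm hn hS' h3 z⟩
    · -- otherwise an arc with at least three vertices has an end vertex
      obtain ⟨u, hu, hu1, hu2, hu3⟩ :
          ∃ u, u ∈ S ∧ u + 1 ∈ S ∧ u + 1 + 1 ∈ S ∧ u + 1 + 1 + 1 ∉ S := by
        by_contra! hno
        push Not at h3
        obtain ⟨x, hx, hx1, hx2⟩ := h3
        obtain ⟨y, hy⟩ : ∃ y, y ∉ S := by
          by_contra! h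
          exact hS (Finset.eq_univ_iff_forall.2 h)
        refine mem_of_closed_sub_one
          (B := fun v => ¬ (v ∈ S ∧ v + 1 ∈ S ∧ v + 1 + 1 ∈ S)) ?_ (x := y) ?_ x ⟨hx, hx1, hx2⟩
        · rintro v hv ⟨h1, h2, h3⟩
          refine hv ⟨?_, ?_, ?_⟩
          · rwa [sub_add_cancel] at h2
          · rwa [sub_add_cancel] at h3
          · have := hno _ h1 h2 h3
            rwa [sub_add_cancel] at this
        · exact fun h => hy h.1
      have hne := add_one_ne_self hm u
      have hne1 := add_one_ne_self hm (u + 1)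
      obtain ⟨Z, hZ⟩ := ih (S.erase (u + 1 + 1)) (Finset.erase_ssubset hu2)
        (fun h => by
          have := Finset.mem_univ (u + 1 + 1)
          rw [← h] at this
          simp at this)
        (by
          intro x hx
          rw [Finset.mem_erase] at hx
          simp only [Finset.mem_erase]
          by_cases hx1 : x = u + 1
          · left
            rw [hx1, add_sub_cancel_right]
            exact ⟨hne.2.1.symm, hu⟩
          · rcases hS' x hx.2 with h | h
            · refine Or.inl ⟨fun h' => hu3 ?_, h⟩
              rw [← h', sub_add_cancel]
              exact hx.2
            · exact Or.inr ⟨fun h' => hx1 (add_right_cancel h'), h⟩)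
      exact ⟨_, hZ.unfold hm hu hu1 hu2 hu3⟩

end Dual

/-! ### The first differential of the generators -/

section Classes

variable {m n t : ℕ} [NeZero m]

/-- The classes of conforming cochains are detected by linear functionals, evaluation on the dual
cycles. -/
theorem exists_dual_functional (hm : 4 ≤ m) (hn : 3 ≤ n) (z : Fin n) {S : Finset (Fin m)}
    (hne : S.Nonempty) (hS : S ≠ Finset.univ) (hS' : ∀ x ∈ S, x - 1 ∈ S ∨ x + 1 ∈ S) {p q : ℤ}
    (hp : p + 1 = S.card) :
    ∃ φ : Cochain (SimpleGraph.cycleGraph m) (⊤ : SimpleGraph (Fin n)) →ₗ[ZMod 2] ZMod 2,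
      (∀ c ∈ firstBoundaries (SimpleGraph.cycleGraph m) ⊤ p q, φ c = 0) ∧
      φ (profile _ ⊤ S (firsts S) fun _ => {z}ᶜ) = 1 ∧
      ∀ c, (∀ η : HomPlus (SimpleGraph.cycleGraph m) (⊤ : SimpleGraph (Fin n)),
        η.supp = S → c η = 0) → φ c = 0 := by
  classical
  obtain ⟨Z, hZ⟩ := exists_isDualCycle hm hn z S hS hS'
  let ind : (Fin m → Finset (Fin n)) → ZMod 2 := fun g => if Z g then 1 else 0
  have hind : ∀ g, ind g ≠ 0 → Z g := fun g h => by
    by_contra h'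
    exact h (if_neg h')
  have hdisj : ∀ g, ind g ≠ 0 → ∀ v w, (SimpleGraph.cycleGraph m).Adj v w →
      Disjoint (g v) (g w) := by
    intro g hg v w hvw
    rw [cycleGraph_adj_iff hm] at hvw
    rcases hvw with rfl | rfl
    · exact (hZ.disjoint g (hind g hg) _).symm
    · exact hZ.disjoint g (hind g hg) _
  let φ : Cochain (SimpleGraph.cycleGraph m) (⊤ : SimpleGraph (Fin n)) →ₗ[ZMod 2] ZMod 2 :=
    ∑ η, ind η.fiber • LinearMap.proj η
  have hφ : ∀ c, φ c = ∑ η, ind η.fiber * c η := fun c => by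
    simp [φ, LinearMap.sum_apply]
  have hzero : ∀ c, (∀ η : HomPlus (SimpleGraph.cycleGraph m) (⊤ : SimpleGraph (Fin n)),
        η.supp = S → c η = 0) → φ c = 0 := by
    intro c hc
    rw [hφ]
    refine Finset.sum_eq_zero fun η _ => ?_
    by_cases h : ind η.fiber = 0
    · rw [h, zero_mul]
    · rw [hc η (HomPlus.supp_eq_iff.2 (hZ.supp _ (hind _ h))), mul_zero]
  refine ⟨φ, ?_, ?_, hzero⟩
  · intro c hc
    obtain ⟨a, ha, b', ⟨b, hb, rfl⟩, rfl⟩ := Submodule.mem_sup.1 hc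
    rw [map_add, hzero a, zero_add, hφ]
    · have h1 : ∀ η : HomPlus (SimpleGraph.cycleGraph m) (⊤ : SimpleGraph (Fin n)),
          ind η.fiber * coboundary _ _ b η =
            ∑ r, b r * if IsFacet r η then ind η.fiber else 0 := by
        intro η
        change _ * (∑ r, if IsFacet r η then b r else 0) = _
        rw [Finset.mul_sum]
        refine Finset.sum_congr rfl fun r _ => ?_
        split_ifs
        · exact mul_comm _ _
        · simp
      rw [Finset.sum_congr rfl fun η _ => h1 η, Finset.sum_comm]
      refine Finset.sum_eq_zero fun r _ => ?_
      rw [← Finset.mul_sum, sum_isFacet_fiber ind hdisj r]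
      by_cases hbr : b r = 0
      · rw [hbr, zero_mul]
      have hcard := (hb r hbr).2
      by_cases hr : r.supp = S
      · have h2 : ∀ v, (∑ a ∈ (r.fiber v)ᶜ,
            ind (Function.update r.fiber v (insert a (r.fiber v)))) = ∑ a, if a ∉ r.fiber v ∧
              Z (Function.update r.fiber v (insert a (r.fiber v))) then 1 else 0 := by
          intro v
          simp only [ite_and, ← Finset.sum_filter, ind]
          refine Finset.sum_congr ?_ fun _ _ => rfl
          ext a
          simp
        rw [Finset.sum_congr rfl fun v _ => h2 v, hZ.even r.fiber (HomPlus.supp_eq_iff.1 hr),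
          mul_zero]
      · rw [Finset.sum_eq_zero, mul_zero]
        intro v _
        refine Finset.sum_eq_zero fun a _ => ?_
        by_contra hne
        have hs := hZ.supp _ (hind _ hne)
        apply hr
        refine Finset.eq_of_subset_of_card_le ?_ (by omega)
        intro w hw
        rw [HomPlus.mem_supp] at hw
        rw [← hs w]
        by_cases hwv : w = v
        · rw [hwv, Function.update_self]
          exact Finset.insert_nonempty _ _
        · rwa [Function.update_of_ne hwv]
    · intro η hη
      by_contra hne
      have := (ha η hne).2
      rw [hη] at this
      omega
  · obtain ⟨g, ⟨hg, hc⟩, huniq⟩ := hZ.unique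
    have hgi : ind g = 1 := if_pos hg
    have hgne : ∃ v, (g v).Nonempty := by
      obtain ⟨v, hv⟩ := hne
      exact ⟨v, (hZ.supp g hg v).2 hv⟩
    have hgd := hdisj g (by rw [hgi]; exact one_ne_zero)
    rw [hφ, Finset.sum_eq_single (HomPlus.ofFiber g hgne hgd)]
    · rw [HomPlus.fiber_ofFiber, hgi, one_mul]
      refine if_pos ?_
      rwa [HomPlus.fiber_ofFiber]
    · intro η _ hη
      by_contra hne'
      have h1 := hind _ (left_ne_zero_of_mul hne')
      have h2 : Conforms S (firsts S) (fun _ => {z}ᶜ) η.fiber := by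
        by_contra h
        exact right_ne_zero_of_mul hne' (if_neg h)
      refine hη (HomPlus.ext_fiber ?_)
      rw [HomPlus.fiber_ofFiber]
      exact huniq _ ⟨h1, h2⟩
    · intro h
      exact absurd (Finset.mem_univ _) h

theorem exists_adj_mem (hm : 4 ≤ m) {S : Finset (Fin m)} (hS : ∀ x ∈ S, x - 1 ∈ S ∨ x + 1 ∈ S)
    {x : Fin m} (hx : x ∈ S) : ∃ u ∈ S, (SimpleGraph.cycleGraph m).Adj x u := by
  rcases hS x hx with h | h
  · exact ⟨_, h, (cycleGraph_adj_iff hm).2 (Or.inl (sub_add_cancel x 1).symm)⟩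
  · exact ⟨_, h, (cycleGraph_adj_iff hm).2 (Or.inr rfl)⟩

/-- Prescribing all colors but one at two vertices of the same run gives a trivial class: one of
the vertices can be moved next to the other. -/
theorem profile_mem_firstBoundaries_of_run (hm : 4 ≤ m) (hn : 3 ≤ n) (z : Fin n)
    {S D : Finset (Fin m)} (hS : ∀ x ∈ S, x - 1 ∈ S ∨ x + 1 ∈ S) (hD : D ⊆ S) {x d : Fin m}
    (h : Run S d x) (hx : x ∈ D) (hd : d ∈ D) (hne : d ≠ x) {p q : ℤ} (hp : p + 1 = S.card)
    (hq : q = D.card * ((n : ℤ) - 2)) :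
    profile _ ⊤ S D (fun _ => {z}ᶜ) ∈
      firstBoundaries (SimpleGraph.cycleGraph m) (⊤ : SimpleGraph (Fin n)) p q := by
  induction h generalizing D with
  | refl _ => exact absurd rfl hne
  | step x hxS h ih =>
    have hadj : (SimpleGraph.cycleGraph m).Adj x (x - 1) :=
      (cycleGraph_adj_iff hm).2 (Or.inl (sub_add_cancel x 1).symm)
    by_cases hx1 : x - 1 ∈ D
    · obtain ⟨a, ha⟩ : ∃ a : Fin n, a ≠ z := by
        have : Nontrivial (Fin n) := Fin.nontrivial_iff_two_le.2 (by omega)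
        exact exists_ne z
      rw [profile_eq_zero_of_overlap hx hx1 hadj (a := a) (by simpa using ha) (by simpa using ha)]
      exact zero_mem _
    · have hx1' : x - 1 ∉ D.erase x := fun h => hx1 (Finset.mem_of_mem_erase h)
      have hDc : (D.erase x).card + 1 = D.card := Finset.card_erase_add_one hx
      have hsub : D.erase x ⊆ S := (Finset.erase_subset _ _).trans hD
      have hmove := profile_move z hxS h.mem hadj hsub
        (Finset.notMem_erase x D) hx1' (fun d hd => exists_adj_mem hm hS (hsub hd))
        (by simpa using hn) (p := p) (q := q) hp
        (by rw [hq, ← hDc, Fintype.card_fin]; push_cast; ring)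
      rw [Finset.insert_erase hx] at hmove
      have hrec := ih (D := insert (x - 1) (D.erase x))
        (Finset.insert_subset h.mem hsub) (Finset.mem_insert_self _ _)
        (Finset.mem_insert_of_mem (Finset.mem_erase.2 ⟨hne, hd⟩)) (fun h => hx1 (h ▸ hd))
        (by rw [Finset.card_insert_of_notMem hx1', hDc, hq])
      have := add_mem hmove hrec
      rwa [sub_add_cancel] at this

theorem mem_firsts_insert {S : Finset (Fin m)} {v x : Fin m} :
    x ∈ firsts (insert v S) ↔ (x = v ∨ x ∈ S) ∧ x - 1 ≠ v ∧ x - 1 ∉ S := by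
  rw [mem_firsts, Finset.mem_insert, Finset.mem_insert, not_or]

/-- Adding a vertex next to an admissible set keeps it admissible if the number of arcs does not
change. -/
theorem Admissible.insert_of_adj {S : Finset (Fin m)} (hS : Admissible t S) {v : Fin m}
    (hv : v - 1 ∈ S ∨ v + 1 ∈ S) (huniv : insert v S ≠ Finset.univ)
    (hcard : (firsts (insert v S)).card = t) : Admissible t (insert v S) := by
  refine ⟨huniv, fun x hx => ?_, fun x => ?_, hcard⟩
  · simp only [Finset.mem_insert] at hx ⊢
    rcases hx with rfl | hx
    · tauto
    · have := hS.not_isolated x hx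
      tauto
  · have := hS.gap x
    simp only [Finset.mem_insert]
    tauto

theorem Admissible.insert_ne_univ {S : Finset (Fin m)} (hS : Admissible t S) {v : Fin m}
    (hv : v ∉ S) (h : 2 ≤ t ∨ S.card + 1 ≠ m) : insert v S ≠ Finset.univ := by
  intro hu
  have hcard := Finset.card_insert_of_notMem hv
  rw [hu, Finset.card_univ, Fintype.card_fin] at hcard
  rcases h with h | h
  · have hsub : firsts S ⊆ {v + 1} := by
      intro d hd
      have h1 : d - 1 ∈ insert v S := hu ▸ Finset.mem_univ _
      rw [Finset.mem_insert, or_iff_left (mem_firsts.1 hd).2] at h1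
      rw [Finset.mem_singleton, ← h1, sub_add_cancel]
    have := Finset.card_le_card hsub
    rw [hS.card_firsts, Finset.card_singleton] at this
    omega
  · exact h hcard.symm

open Classical in
/-- Adding one vertex to the support: the class is that of the enlarged arc picture, or zero if
two arcs are merged. -/
theorem profile_insert_sub_mem (hm : 4 ≤ m) (hn : 3 ≤ n) (z : Fin n) {S : Finset (Fin m)}
    (hS : Admissible t S) {v : Fin m} (hv : v ∉ S) (huniv : insert v S ≠ Finset.univ) {p q : ℤ}
    (hp : p + 1 = (insert v S).card) (hq : q = t * ((n : ℤ) - 2)) :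
    profile _ ⊤ (insert v S) (firsts S) (fun _ => {z}ᶜ) -
      (if Admissible t (insert v S) then
        profile _ ⊤ (insert v S) (firsts (insert v S)) fun _ => {z}ᶜ else 0) ∈
      firstBoundaries (SimpleGraph.cycleGraph m) (⊤ : SimpleGraph (Fin n)) p q := by
  have hne := add_one_ne_self hm v
  have hfS : firsts S ⊆ S := Finset.filter_subset _ _
  have hfS' : firsts S ⊆ insert v S := hfS.trans (Finset.subset_insert _ _)
  have hgap := hS.gap (v - 1)
  rw [sub_add_cancel] at hgap
  have hiso : v - 1 ∈ S ∨ v + 1 ∈ S →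
      ∀ x ∈ insert v S, x - 1 ∈ insert v S ∨ x + 1 ∈ insert v S := by
    intro h x hx
    simp only [Finset.mem_insert] at hx ⊢
    rcases hx with rfl | hx
    · tauto
    · have := hS.not_isolated x hx
      tauto
  by_cases h1 : v - 1 ∈ S
  · by_cases h2 : v + 1 ∈ S
    · -- two arcs are merged
      have hv1 : v + 1 ∈ firsts S := by
        rw [mem_firsts, add_sub_cancel_right]
        exact ⟨h2, hv⟩
      have hfirsts : firsts (insert v S) = (firsts S).erase (v + 1) := by
        ext x
        rw [mem_firsts_insert, Finset.mem_erase, mem_firsts]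
        constructor
        · rintro ⟨rfl | hx, hx1, hx2⟩
          · exact absurd h1 hx2
          · exact ⟨fun h => hx1 (by rw [h, add_sub_cancel_right]), hx, hx2⟩
        · rintro ⟨hx1, hx, hx2⟩
          exact ⟨Or.inr hx, fun h => hx1 (by rw [← h, sub_add_cancel]), hx2⟩
      have hnot : ¬ Admissible t (insert v S) := by
        intro h
        have := h.card_firsts
        rw [hfirsts, Finset.card_erase_of_mem hv1, hS.card_firsts] at this
        have := Finset.card_pos.2 ⟨_, hv1⟩
        rw [hS.card_firsts] at this
        omega
      rw [if_neg hnot, sub_zero]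
      obtain ⟨d, hd, hrun⟩ := exists_run huniv (Finset.mem_insert_of_mem h2)
      rw [hfirsts, Finset.mem_erase] at hd
      exact profile_mem_firstBoundaries_of_run hm hn z (hiso (Or.inl h1)) hfS' hrun hv1 hd.2 hd.1 hp
        (by rw [hq, hS.card_firsts])
    · have hfirsts : firsts (insert v S) = firsts S := by
        ext x
        rw [mem_firsts_insert, mem_firsts]
        constructor
        · rintro ⟨rfl | hx, hx1, hx2⟩
          · exact absurd h1 hx2
          · exact ⟨hx, hx2⟩
        · rintro ⟨hx, hx2⟩
          refine ⟨Or.inr hx, fun h => h2 ?_, hx2⟩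
          rwa [← h, sub_add_cancel]
      have had := hS.insert_of_adj (Or.inl h1) huniv (by rw [hfirsts, hS.card_firsts])
      rw [if_pos had, hfirsts, sub_self]
      exact zero_mem _
  · have h2 : v + 1 ∈ S := by tauto
    have hv1 : v + 1 ∈ firsts S := by
      rw [mem_firsts, add_sub_cancel_right]
      exact ⟨h2, hv⟩
    have hfirsts : firsts (insert v S) = insert v ((firsts S).erase (v + 1)) := by
      ext x
      rw [mem_firsts_insert, Finset.mem_insert, Finset.mem_erase, mem_firsts]
      constructor
      · rintro ⟨rfl | hx, hx1, hx2⟩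
        · exact Or.inl rfl
        · exact Or.inr ⟨fun h => hx1 (by rw [h, add_sub_cancel_right]), hx, hx2⟩
      · rintro (rfl | ⟨hx1, hx, hx2⟩)
        · exact ⟨Or.inl rfl, fun h => (add_one_ne_self hm (x - 1)).1 (by
            rw [sub_add_cancel, h]), h1⟩
        · exact ⟨Or.inr hx, fun h => hx1 (by rw [← h, sub_add_cancel]), hx2⟩
    have hvD : v ∉ (firsts S).erase (v + 1) := fun h => hv (hfS (Finset.mem_of_mem_erase h))
    have hcard := Finset.card_erase_add_one hv1
    have had := hS.insert_of_adj (Or.inr h2) huniv (by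
      rw [hfirsts, Finset.card_insert_of_notMem hvD, hcard, hS.card_firsts])
    have hsub : (firsts S).erase (v + 1) ⊆ insert v S := (Finset.erase_subset _ _).trans hfS'
    have hmove := profile_move z (Finset.mem_insert_of_mem h2) (Finset.mem_insert_self v S)
      ((cycleGraph_adj_iff hm).2 (Or.inl rfl)) hsub (Finset.notMem_erase _ _) hvD
      (fun d hd => exists_adj_mem hm (hiso (Or.inr h2)) (hsub hd)) (by simpa using hn)
      (p := p) (q := q) hp
      (by rw [hq, Fintype.card_fin, ← hS.card_firsts, ← hcard]; push_cast; ring)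
    rwa [Finset.insert_erase hv1, ← hfirsts, ← if_pos (c := Admissible t (insert v S))
      (t := profile _ ⊤ (insert v S) (firsts (insert v S)) fun _ => {z}ᶜ)
      (e := (0 : Cochain (SimpleGraph.cycleGraph m) (⊤ : SimpleGraph (Fin n)))) had] at hmove

theorem Admissible.nonempty (ht : 1 ≤ t) {S : Finset (Fin m)} (hS : Admissible t S) :
    S.Nonempty := by
  obtain ⟨d, hd⟩ := Finset.card_pos.1 (hS.card_firsts ▸ ht)
  exact ⟨d, (mem_firsts.1 hd).1⟩

theorem Admissible.profile_mem_firstCycles (hm : 4 ≤ m) (hn : 3 ≤ n) (ht : 1 ≤ t) (z : Fin n)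
    {S : Finset (Fin m)} (hS : Admissible t S) {p : ℤ} (hp : p + 1 = S.card) :
    profile _ ⊤ S (firsts S) (fun _ => {z}ᶜ) ∈ firstCycles (SimpleGraph.cycleGraph m)
      (⊤ : SimpleGraph (Fin n)) p (t * ((n : ℤ) - 2)) := by
  have hfS : firsts S ⊆ S := Finset.filter_subset _ _
  refine CycleColorings.profile_mem_firstCycles (hS.nonempty ht) hfS
    (fun d hd => exists_adj_mem hm hS.not_isolated (hfS hd)) z ?_ hp ?_
  · rw [Fintype.card_fin]; omega
  · rw [Fintype.card_fin, hS.card_firsts]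

open Classical in
/-- The first differential of the class of an arc picture: a vertex is added to the support in
all ways which keep the number of arcs. -/
theorem Admissible.coboundary_sub_mem (hm : 4 ≤ m) (hn : 3 ≤ n) (ht : 1 ≤ t) (z : Fin n)
    {S : Finset (Fin m)} (hS : Admissible t S) {p : ℤ} (hp : p + 1 = S.card)
    (h : 2 ≤ t ∨ p ≠ (m : ℤ) - 2) :
    coboundary _ ⊤ (profile _ ⊤ S (firsts S) (fun _ => {z}ᶜ)) -
      (∑ v ∈ Sᶜ, if Admissible t (insert v S) then
        profile _ ⊤ (insert v S) (firsts (insert v S)) fun _ => {z}ᶜ else 0) ∈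
      firstBoundaries (SimpleGraph.cycleGraph m) (⊤ : SimpleGraph (Fin n)) (p + 1)
        (t * ((n : ℤ) - 2)) := by
  have hfS : firsts S ⊆ S := Finset.filter_subset _ _
  rw [coboundary_profile_compl_singleton (hS.nonempty ht) hfS
    (fun d hd => exists_adj_mem hm hS.not_isolated (hfS hd)) z (by rw [Fintype.card_fin]; omega),
    ← Finset.sum_sub_distrib]
  refine Submodule.sum_mem _ fun v hv => ?_
  have hv := Finset.mem_compl.1 hv
  have huniv := hS.insert_ne_univ hv (by omega)
  refine profile_insert_sub_mem hm hn z hS hv huniv ?_ rfl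
  · rw [Finset.card_insert_of_notMem hv, hp]; push_cast; ring

end Classes

/-! ### Comparison with the chain complex of cubes -/

section Comparison

variable {m n t : ℕ} [NeZero m]

theorem ArcPicture.sigma_eq (P : ArcPicture m t) (hP : P.first = firsts P.S) (z : Fin n)
    (hz : (z : ℕ) + 1 = n) :
    P.sigma n = profile _ ⊤ P.S (firsts P.S) fun _ => {z}ᶜ := by
  classical
  have hN : (Finset.univ.filter fun k : Fin n => (k : ℕ) + 1 < n) = {z}ᶜ := by
    ext k
    rw [Finset.mem_filter, Finset.mem_compl, Finset.mem_singleton, Fin.ext_iff]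
    have := k.isLt
    have := Finset.mem_univ k
    grind
  funext η
  refine if_congr ?_ rfl rfl
  rw [hP, hN, HomPlus.supp_eq_iff]
  constructor
  · rintro ⟨h1, h2, h3⟩ v
    exact ⟨h1 v, h2 v, h3 v⟩
  · intro h
    exact ⟨fun v => (h v).1, fun v => (h v).2.1, fun v => (h v).2.2⟩

theorem PhiCell.card_compl_points (hm : 4 ≤ m) {i p : ℤ} (hp : p = (m : ℤ) - t - i - 1)
    (c : PhiCell t m 3 i) : p + 1 = (c.1.pointsᶜ.card : ℤ) := by
  rw [PhiCube.card_compl_points hm c.1, c.2, hp]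
  ring

/-- The cochain `σ` of the arc picture whose arcs are the runs of vertices not covered by a
cube. -/
def cellCycle (hm : 4 ≤ m) (hn : 3 ≤ n) (ht : 1 ≤ t) (z : Fin n) {i p : ℤ}
    (hp : p = (m : ℤ) - t - i - 1) (c : PhiCell t m 3 i) :
    firstCycles (SimpleGraph.cycleGraph m) (⊤ : SimpleGraph (Fin n)) p (t * ((n : ℤ) - 2)) :=
  ⟨profile _ ⊤ c.1.pointsᶜ (firsts c.1.pointsᶜ) fun _ => {z}ᶜ,
    (PhiCube.admissible_compl_points hm ht c.1).profile_mem_firstCycles hm hn ht z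
      (PhiCell.card_compl_points hm hp c)⟩

/-- The class attached to a cube. -/
def cellClass (hm : 4 ≤ m) (hn : 3 ≤ n) (ht : 1 ≤ t) (z : Fin n) {i p : ℤ}
    (hp : p = (m : ℤ) - t - i - 1) (c : PhiCell t m 3 i) : RowPage m n t p :=
  Submodule.Quotient.mk (cellCycle hm hn ht z hp c)

theorem span_cellClass (hm : 4 ≤ m) (hn : 3 ≤ n) (ht : 1 ≤ t) (z : Fin n) (hz : (z : ℕ) + 1 = n)
    {i p : ℤ} (hp : p = (m : ℤ) - t - i - 1) :
    Submodule.span (ZMod 2) (Set.range (cellClass hm hn ht z hp)) = arcModule m n t p := by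
  refine congrArg _ (Set.ext fun x => ⟨?_, ?_⟩)
  · rintro ⟨c, rfl⟩
    have hS := PhiCube.admissible_compl_points hm ht c.1
    have hs : (hS.picture hm).sigma n = cellCycle hm hn ht z hp c :=
      ArcPicture.sigma_eq _ (ArcPicture.first_eq _ rfl) z hz
    refine ⟨hS.picture hm, (PhiCell.card_compl_points hm hp c).symm, hS.hat_picture hm,
      hs ▸ (cellCycle hm hn ht z hp c).2, ?_⟩
    exact congrArg Submodule.Quotient.mk (Subtype.ext hs.symm)
  · rintro ⟨P, hP, hhat, h, rfl⟩
    obtain ⟨hS, hA⟩ := P.admissible_of_hat hm hhat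
    have hs := P.sigma_eq (P.first_eq hA) z hz
    have hdim : ((hS.cube hm).dim : ℤ) = i := by
      have := PhiCube.card_compl_points hm (hS.cube hm)
      rw [hS.compl_points_cube hm] at this
      omega
    refine ⟨⟨hS.cube hm, hdim⟩, congrArg Submodule.Quotient.mk (Subtype.ext ?_)⟩
    refine Eq.trans ?_ hs.symm
    change profile _ ⊤ (hS.cube hm).pointsᶜ (firsts (hS.cube hm).pointsᶜ) _ = _
    rw [hS.compl_points_cube hm]

theorem linearIndependent_cellClass (hm : 4 ≤ m) (hn : 3 ≤ n) (ht : 1 ≤ t) (z : Fin n)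
    {i p : ℤ} (hp : p = (m : ℤ) - t - i - 1) :
    LinearIndependent (ZMod 2) (cellClass hm hn ht z hp) := by
  rw [Fintype.linearIndependent_iff]
  intro g hg c
  have hS := PhiCube.admissible_compl_points hm ht c.1
  obtain ⟨φ, hφ, hφ1, hφ0⟩ := exists_dual_functional hm hn z (hS.nonempty ht) hS.ne_univ
    hS.not_isolated (q := t * ((n : ℤ) - 2)) (PhiCell.card_compl_points hm hp c)
  let ψ : RowPage m n t p →ₗ[ZMod 2] ZMod 2 := Submodule.liftQ _
    (φ ∘ₗ (firstCycles (SimpleGraph.cycleGraph m) (⊤ : SimpleGraph (Fin n)) p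
      (t * ((n : ℤ) - 2))).subtype) fun x hx => hφ _ hx
  have hψ : ∀ c', ψ (cellClass hm hn ht z hp c') = φ (cellCycle hm hn ht z hp c').1 :=
    fun c' => rfl
  have h := congrArg ψ hg
  rw [map_sum, map_zero, Finset.sum_eq_single c] at h
  · rwa [map_smul, hψ, cellCycle, hφ1, smul_eq_mul, mul_one] at h
  · intro c' _ hne
    rw [map_smul, hψ, hφ0, smul_zero]
    intro η hη
    refine if_neg fun hconf => hne (Subtype.ext (PhiCube.points_injective hm ?_))
    rw [← compl_inj_iff, ← hη]
    exact (HomPlus.supp_eq_iff.2 fun v => (hconf v).1).symm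
  · intro h'
    exact absurd (Finset.mem_univ c) h'

/-- The linear map from chains to the first page which sends each cube to its class. -/
def chainMap (hm : 4 ≤ m) (hn : 3 ≤ n) (ht : 1 ≤ t) (z : Fin n) {i p : ℤ}
    (hp : p = (m : ℤ) - t - i - 1) : PhiChain t m 3 i →ₗ[ZMod 2] RowPage m n t p :=
  Fintype.linearCombination (ZMod 2) (cellClass hm hn ht z hp)

theorem chainMap_apply (hm : 4 ≤ m) (hn : 3 ≤ n) (ht : 1 ≤ t) (z : Fin n) {i p : ℤ}
    (hp : p = (m : ℤ) - t - i - 1) (f : PhiChain t m 3 i) :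
    chainMap hm hn ht z hp f = ∑ c, f c • cellClass hm hn ht z hp c :=
  Fintype.linearCombination_apply _ _ _

theorem range_chainMap (hm : 4 ≤ m) (hn : 3 ≤ n) (ht : 1 ≤ t) (z : Fin n) (hz : (z : ℕ) + 1 = n)
    {i p : ℤ} (hp : p = (m : ℤ) - t - i - 1) :
    LinearMap.range (chainMap hm hn ht z hp) = arcModule m n t p := by
  rw [chainMap, Fintype.range_linearCombination, span_cellClass hm hn ht z hz]

theorem chainMap_injective (hm : 4 ≤ m) (hn : 3 ≤ n) (ht : 1 ≤ t) (z : Fin n) {i p : ℤ}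
    (hp : p = (m : ℤ) - t - i - 1) : Function.Injective (chainMap hm hn ht z hp) :=
  LinearIndependent.fintypeLinearCombination_injective (linearIndependent_cellClass hm hn ht z hp)

open Classical in
/-- Faces of codimension one correspond to the admissible sets with one more vertex. -/
theorem sum_faces_eq (hm : 4 ≤ m) (ht : 1 ≤ t) {i : ℤ} (c : PhiCell t m 3 i) {M : Type*}
    [AddCommMonoid M] (f : Finset (Fin m) → M) :
    (∑ c' : PhiCell t m 3 (i - 1), if c'.1.IsFace c.1 then f c'.1.pointsᶜ else 0) =
      ∑ v ∈ (c.1.pointsᶜ)ᶜ, if Admissible t (insert v c.1.pointsᶜ) then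
        f (insert v c.1.pointsᶜ) else 0 := by
  rw [← Finset.sum_filter, ← Finset.sum_filter]
  have hcS := PhiCell.card_compl_points hm rfl c
  set S := c.1.pointsᶜ
  rw [← Finset.sum_image (f := f) (g := fun c' : PhiCell t m 3 (i - 1) => c'.1.pointsᶜ),
    ← Finset.sum_image (f := f) (g := fun v => insert v S)]
  · refine Finset.sum_congr (Finset.ext fun S' => ?_) fun _ _ => rfl
    simp only [Finset.mem_image, Finset.mem_filter, Finset.mem_univ, true_and]
    constructor
    · rintro ⟨c', hface, rfl⟩
      have hsub : S ⊆ c'.1.pointsᶜ :=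
        Finset.compl_subset_compl.2 ((PhiCube.isFace_iff hm).1 hface)
      have hcS' := PhiCell.card_compl_points hm rfl c'
      obtain ⟨v, hv, he⟩ := Finset.exists_eq_insert_iff.2 ⟨hsub, by omega⟩
      exact ⟨v, ⟨Finset.mem_compl.2 hv, he ▸ PhiCube.admissible_compl_points hm ht c'.1⟩, he⟩
    · rintro ⟨v, ⟨hv, had⟩, rfl⟩
      have hcard := Finset.card_insert_of_notMem (Finset.mem_compl.1 hv)
      have hdim := PhiCube.card_compl_points hm (had.cube hm)
      have hpts := had.compl_points_cube hm
      rw [hpts] at hdim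
      refine ⟨⟨had.cube hm, by omega⟩, (PhiCube.isFace_iff hm).2 ?_, hpts⟩
      rw [← Finset.compl_subset_compl, hpts]
      exact Finset.subset_insert _ _
  · intro v hv w hw h
    exact (Finset.insert_inj (Finset.mem_compl.1 (Finset.mem_filter.1 hv).1)).1 h
  · intro c' _ c'' _ h
    exact Subtype.ext (PhiCube.points_injective hm (compl_injective h))

open Classical in
theorem rowDifferential_cellClass (hm : 4 ≤ m) (hn : 3 ≤ n) (ht : 1 ≤ t) (z : Fin n) {i p : ℤ}
    (hp : p = (m : ℤ) - t - i - 1) (hp' : p + 1 = (m : ℤ) - t - (i - 1) - 1)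
    (h : 2 ≤ t ∨ i ≠ 0) (c : PhiCell t m 3 i) :
    rowDifferential m n t p (cellClass hm hn ht z hp c) =
      ∑ c' : PhiCell t m 3 (i - 1),
        if c'.1.IsFace c.1 then cellClass hm hn ht z hp' c' else 0 := by
  have hS := PhiCube.admissible_compl_points hm ht c.1
  have hsum : (∑ c' : PhiCell t m 3 (i - 1),
      if c'.1.IsFace c.1 then cellClass hm hn ht z hp' c' else 0) =
      Submodule.mkQ _ (∑ c' : PhiCell t m 3 (i - 1),
        if c'.1.IsFace c.1 then cellCycle hm hn ht z hp' c' else 0) := by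
    rw [map_sum]
    refine Finset.sum_congr rfl fun c' _ => ?_
    split_ifs
    · rfl
    · exact (map_zero _).symm
  rw [hsum]
  refine (Submodule.Quotient.eq _).2 ?_
  have key := hS.coboundary_sub_mem hm hn ht z (PhiCell.card_compl_points hm hp c) (by omega)
  rw [← sum_faces_eq hm ht c (fun S => profile (SimpleGraph.cycleGraph m)
    (⊤ : SimpleGraph (Fin n)) S (firsts S) fun _ => {z}ᶜ)] at key
  change coboundary _ _ (cellCycle hm hn ht z hp c).1 - Subtype.val _ ∈ firstBoundaries _ _ _ _
  refine (congrArg (fun x => coboundary _ _ (cellCycle hm hn ht z hp c).1 - x ∈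
    firstBoundaries _ _ _ _) ?_).mpr key
  rw [AddSubmonoidClass.coe_finsetSum]
  refine Finset.sum_congr rfl fun c' _ => ?_
  split_ifs <;> rfl

theorem rowDifferential_chainMap (hm : 4 ≤ m) (hn : 3 ≤ n) (ht : 1 ≤ t) (z : Fin n) {i p : ℤ}
    (hp : p = (m : ℤ) - t - i - 1) (hp' : p + 1 = (m : ℤ) - t - (i - 1) - 1)
    (h : 2 ≤ t ∨ i ≠ 0) (f : PhiChain t m 3 i) :
    rowDifferential m n t p (chainMap hm hn ht z hp f) =
      chainMap hm hn ht z hp' (phiBoundary t m 3 i f) := by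
  classical
  rw [chainMap_apply, chainMap_apply, map_sum]
  have h1 : ∀ c', phiBoundary t m 3 i f c' • cellClass hm hn ht z hp' c' =
      ∑ c : PhiCell t m 3 i,
        f c • if c'.1.IsFace c.1 then cellClass hm hn ht z hp' c' else 0 := by
    intro c'
    change (∑ c : PhiCell t m 3 i, if c'.1.IsFace c.1 then f c else 0) • _ = _
    rw [Finset.sum_smul]
    refine Finset.sum_congr rfl fun c _ => ?_
    split_ifs <;> simp
  rw [Finset.sum_congr rfl fun c' _ => h1 c', Finset.sum_comm]
  refine Finset.sum_congr rfl fun c _ => ?_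
  rw [map_smul, rowDifferential_cellClass hm hn ht z hp hp' h, Finset.smul_sum]

end Comparison

end CycleColorings

end

open CycleColorings
theorem proposition4p2 (m n t : ℕ) [NeZero m] (hm : 4 ≤ m) (hn : 3 ≤ n) (ht : 1 ≤ t) :
    (∀ p : ℤ, (2 ≤ t ∨ p ≠ (m : ℤ) - 2) →
      ∀ x ∈ arcModule m n t p, rowDifferential m n t p x ∈ arcModule m n t (p + 1)) ∧
    ∃ e : ∀ i p : ℤ, p = (m : ℤ) - t - i - 1 → (PhiChain t m 3 i ≃ₗ[ZMod 2] arcModule m n t p),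
      ∀ (i p : ℤ) (hp : p = (m : ℤ) - t - i - 1) (hp' : p + 1 = (m : ℤ) - t - (i - 1) - 1),
        (2 ≤ t ∨ i ≠ 0) → ∀ c : PhiChain t m 3 i,
          (e (i - 1) (p + 1) hp' (phiBoundary t m 3 i c) : RowPage m n t (p + 1)) =
            rowDifferential m n t p (e i p hp c : RowPage m n t p) := by
  obtain ⟨z, hz⟩ : ∃ z : Fin n, (z : ℕ) + 1 = n := ⟨⟨n - 1, by omega⟩, by simp; omega⟩
  refine ⟨fun p h x hx => ?_, fun i p hp => (LinearEquiv.ofInjective _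
    (chainMap_injective hm hn ht z hp)).trans (LinearEquiv.ofEq _ _
      (range_chainMap hm hn ht z hz hp)), fun i p hp hp' h c => ?_⟩
  · have hp : p = (m : ℤ) - t - (m - t - p - 1) - 1 := by ring
    have hp' : p + 1 = (m : ℤ) - t - ((m - t - p - 1) - 1) - 1 := by ring
    rw [← range_chainMap hm hn ht z hz hp] at hx
    obtain ⟨f, rfl⟩ := hx
    rw [rowDifferential_chainMap hm hn ht z hp hp' (by omega),
      ← range_chainMap hm hn ht z hz hp']
    exact LinearMap.mem_range_self _ _
  · exact (rowDifferential_chainMap hm hn ht z hp hp' h c).symm
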